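/- Let $n\ge 1$, let $\boldsymbol\mu=(\mu_1,\dots,\mu_n)\in\mathbb L^{n-1}=\{\boldsymbol\mu\in\mathbb C^n:\sum_l\mu_l=0\}$ and $\boldsymbol m=(m_1,\dots,m_n)\in\mathbb Z^n$. **Bessel kernel.** For $m\in\mathbb Z$ put $G_m(s)=i^{|m|}(2\pi)^{1-2s}\,\Gamma(s+\frac{|m|}2)/\Gamma(1-s+\frac{|m|}2)$ and $G_{(\boldsymbol\mu,\boldsymbol m)}(s)=\prod_{l=1}^nG_{m_l}(s-\mu_l)$. For $x>0$ let $$j_{(\boldsymbol\mu,\boldsymbol m)}(x)=\frac1{2\pi i}\int_{\mathcal C_{(\boldsymbol\mu,\boldsymbol m)}}G_{(\boldsymbol\mu,\boldsymbol m)}(s)\,x^{-2s}\,ds ,$$ where $\mathcal C_{(\boldsymbol\mu,\boldsymbol m)}$ is any polygonal contour $\sigma-i\infty\to\sigma-iT\to\rho-iT\to\rho+iT\to\sigma+iT\to\sigma+i\infty$ with $\sigma<\frac12+\frac1n\left(\mathrm{Re}\sum_l\mu_l-\frac12\right)$, $\rho>\mathrm{Re}\,\mu_l-\frac12|m_l|$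 and $T>|\mathrm{Im}\,\mu_l|$ for all $l$ (so that all the sets $\mu_l-\frac12|m_l|-\mathbb N$ lie to its left). The complex Bessel kernel is $$J_{(\boldsymbol\mu,\boldsymbol m)}(z)=\frac1{2\pi}\sum_{k\in\mathbb Z}j_{(\boldsymbol\mu,\boldsymbol m+k(1,\dots,1))}(|z|)\,(z/|z|)^k,\qquad z\in\mathbb C\smallsetminus\{0\}.$$ **Bessel functions of the first kind.** For $\boldsymbol\lambda\in\mathbb C^n$, $l=1,\dots,n$ and $z$ in the universal cover of $\mathbb C\smallsetminus\{0\}$ (where $z^a=e^{a\log z}$) let $$J_l(z;+,\boldsymbol\lambda)=\sum_{j=0}^\infty\frac{i^{nj}\,z^{n(-\lambda_l+j)}}{\prod_{k=1}^n\Gamma(\lambda_k-\lambda_l+j+1)} .$$ Call $(\boldsymbol\mu,\boldsymbol m)$ generic if $2(\mu_l-\mu_k)-|m_l-m_k|\notin2\mathbb Z$ for all $l\ne k$. For generic $(\boldsymbol\mu,\boldsymbol m)$ and either choice of the sign $\pm$ (the same in all places) put $$S_l(\boldsymbol\mu,\boldsymbol m)=\prod_{k\ne l}\frac{(\pm i)^{m_l-m_k}}{\sin\left(\pi\left(\mu_l-\mu_k\pm\frac12(m_l-m_k)\right)\right)}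 .$$ **Theorem.** The integrals and the series that define $J_{(\boldsymbol\mu,\boldsymbol m)}$ converge absolutely. Let $x>0$, $\phi\in\mathbb R$, $z=xe^{i\phi}$, $z^{1/n}=x^{1/n}e^{i\phi/n}$ and $\overline z^{1/n}=x^{1/n}e^{-i\phi/n}$. If $(\boldsymbol\mu,\boldsymbol m)$ is generic, then for either choice of the sign $$J_{(\boldsymbol\mu,\boldsymbol m)}(z)=(2\pi^2)^{n-1}\sum_{l=1}^nS_l(\boldsymbol\mu,\boldsymbol m)\,J_l\left(2\pi z^{1/n};+,\boldsymbol\mu+\tfrac12\boldsymbol m\right)J_l\left(2\pi\overline z^{1/n};+,\boldsymbol\mu-\tfrac12\boldsymbol m\right).$$ In particular, the right-hand side does not depend on the choice of the argument $\phi$ of $z$ modulo $2\pi$. If $(\boldsymbol\mu,\boldsymbol m)$ is not generic, the same holds with the right-hand side replaced by its limit as $\boldsymbol\mu'\to\boldsymbol\mu$ through those $\boldsymbol\mu'\in\mathbb L^{n-1}$ for which $(\boldsymbol\mu',\boldsymbol m)$ is generic; such $\boldsymbol\mu'$ exist arbitrarily close to $\boldsymbol\mu$, and the limit exists. -/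

import Mathlib

open Complex MeasureTheory Filter Topology Set

noncomputable section

namespace BesselKernel

/-- The complex hyperplane `L^{n-1}` of all `μ ∈ ℂ^n` with `μ_1 + ... + μ_n = 0`. -/
def hyperplane (n : ℕ) : Set (Fin n → ℂ) := {μ | ∑ l, μ l = 0}

/-! ### Genericity -/

/-- The relation `(lam, a) ∼ (lam', a')` on `ℂ × ℤ`, namely `lam' - lam - |a' - a| ∈ 2ℤ`. -/
def Sim (p q : ℂ × ℤ) : Prop := ∃ k : ℤ, q.1 - p.1 - ((|q.2 - p.2| : ℤ) : ℂ) = 2 * (k : ℂ)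

/-- `(μ, m)` is generic: no two of the pairs `(2 μ_l, m_l)` are related by `∼`. -/
def Generic {n : ℕ} (μ : Fin n → ℂ) (m : Fin n → ℤ) : Prop :=
  ∀ l k : Fin n, l ≠ k → ¬ Sim (2 * μ l, m l) (2 * μ k, m k)

/-- All `ν` in the hyperplane such that `(ν, m)` is generic. -/
def genericSet {n : ℕ} (m : Fin n → ℤ) : Set (Fin n → ℂ) :=
  {ν | ν ∈ hyperplane n ∧ Generic ν m}

/-! ### Gamma factors -/

/-- `G_m(s) = i^|m| (2π)^(1-2s) Γ(s + |m|/2) / Γ(1 - s + |m|/2)`. -/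
def gammaFactor (m : ℤ) (s : ℂ) : ℂ :=
  I ^ m.natAbs * ((2 * Real.pi : ℝ) : ℂ) ^ (1 - 2 * s)
    * (Gamma (s + ((|m| : ℤ) : ℂ) / 2) / Gamma (1 - s + ((|m| : ℤ) : ℂ) / 2))

/-- `G_(μ,m)(s) = ∏_l G_{m_l}(s - μ_l)`. -/
def gammaProd {n : ℕ} (μ : Fin n → ℂ) (m : Fin n → ℤ) (s : ℂ) : ℂ :=
  ∏ l, gammaFactor (m l) (s - μ l)

/-! ### Mellin-Barnes contours and the Bessel kernel -/

/-- The data of an admissible contour for the index `(μ, m)`. The contour is the upward directed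
polygonal line
`σ - i∞ ⟶ σ - iT ⟶ ρ - iT ⟶ ρ + iT ⟶ σ + iT ⟶ σ + i∞`.
The last two conditions say that all the sets `μ_l - |m_l|/2 - ℕ` lie on its left side. -/
structure Contour {n : ℕ} (μ : Fin n → ℂ) (m : Fin n → ℤ) where
  σ : ℝ
  ρ : ℝ
  T : ℝ
  σ_lt : σ < 1 / 2 + (1 / (n : ℝ)) * ((∑ l, μ l).re - 1 / 2)
  lt_ρ : ∀ l, (μ l).re - ((|m l| : ℤ) : ℝ) / 2 < ρ
  lt_T : ∀ l, |(μ l).im| < T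

/-- Admissible contours exist for every index. -/
theorem contour_nonempty {n : ℕ} (μ : Fin n → ℂ) (m : Fin n → ℤ) : Nonempty (Contour μ m) := by
  have key : ∀ f : Fin n → ℝ, ∃ B : ℝ, ∀ l, f l < B := by
    intro f
    obtain ⟨B, hB⟩ := (Set.finite_range f).bddAbove
    exact ⟨B + 1, fun l => lt_of_le_of_lt (hB ⟨l, rfl⟩) (lt_add_one B)⟩
  obtain ⟨ρ, hρ⟩ := key (fun l => (μ l).re - ((|m l| : ℤ) : ℝ) / 2)
  obtain ⟨T, hT⟩ := key (fun l => |(μ l).im|)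
  exact ⟨⟨_, ρ, T, sub_one_lt _, hρ, hT⟩⟩

/-- The integrand `G_(μ,m)(s) x^(-2s)`. -/
def integrand {n : ℕ} (μ : Fin n → ℂ) (m : Fin n → ℤ) (x : ℝ) (s : ℂ) : ℂ :=
  gammaProd μ m s * (x : ℂ) ^ (-2 * s)

/-- The integral of `F(s) ds` along the polygonal line
`σ - i∞ ⟶ σ - iT ⟶ ρ - iT ⟶ ρ + iT ⟶ σ + iT ⟶ σ + i∞`. -/
def contourIntegral (σ ρ T : ℝ) (F : ℂ → ℂ) : ℂ :=
  (∫ t in Iic (-T), F (σ + t * I) * I)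
    + (∫ u in σ..ρ, F (u - T * I))
    + (∫ t in (-T)..T, F (ρ + t * I) * I)
    + (∫ u in ρ..σ, F (u + T * I))
    + (∫ t in Ioi T, F (σ + t * I) * I)

/-- Absolute convergence of the contour integral on its two infinite vertical half lines. -/
def ContourConverges (σ T : ℝ) (F : ℂ → ℂ) : Prop :=
  IntegrableOn (fun t : ℝ => F (σ + t * I)) (Iic (-T)) ∧
    IntegrableOn (fun t : ℝ => F (σ + t * I)) (Ioi T)

/-- `j_(μ,m)(x) = (1 / 2πi) ∫_C G_(μ,m)(s) x^(-2s) ds`, for `x > 0`. -/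
def smallKernel {n : ℕ} (μ : Fin n → ℂ) (m : Fin n → ℤ) (C : Contour μ m) (x : ℝ) : ℂ :=
  1 / (2 * Real.pi * I) * contourIntegral C.σ C.ρ C.T (integrand μ m x)

/-- The index `m + k e^n`, where `e^n = (1, ..., 1)`. -/
def shift {n : ℕ} (m : Fin n → ℤ) (k : ℤ) : Fin n → ℤ := fun l => m l + k

/-- The `k`-th term `j_(μ, m + k e^n)(|z|) [z]^k`, where `[z] = z / |z|`. -/
def kernelTerm {n : ℕ} (μ : Fin n → ℂ) (m : Fin n → ℤ) (C : ∀ k : ℤ, Contour μ (shift m k))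
    (z : ℂ) (k : ℤ) : ℂ :=
  smallKernel μ (shift m k) (C k) ‖z‖ * (z / (‖z‖ : ℂ)) ^ k

/-- The complex Bessel kernel
`J_(μ,m)(z) = (1 / 2π) ∑_{k ∈ ℤ} j_(μ, m + k e^n)(|z|) [z]^k`, for `z ≠ 0`. -/
def kernel {n : ℕ} (μ : Fin n → ℂ) (m : Fin n → ℤ) (C : ∀ k : ℤ, Contour μ (shift m k))
    (z : ℂ) : ℂ :=
  1 / (2 * Real.pi) * ∑' k : ℤ, kernelTerm μ m C z k

/-! ### Bessel functions of the first kind -/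

/-- `z^a = exp (a log z)` for the point `z = r e^{iω}`, `log z = log r + iω`, of the universal
cover of `ℂ ∖ {0}`, identified with `(0, ∞) × ℝ ∋ (r, ω)`. -/
def coverPow (r ω : ℝ) (a : ℂ) : ℂ := exp (a * ((Real.log r : ℂ) + ω * I))

/-- `J_l(z; ς, lam) = ∑_{j ≥ 0} (ς i^n)^j z^{n(-lam_l + j)} / ∏_k Γ(lam_k - lam_l + j + 1)` for the
sign `ς` and the point `z = r e^{iω}` of the universal cover of `ℂ ∖ {0}`. (If the argument of a
Gamma factor is a pole, then `1 / Γ = 0` there, as usual.) -/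
def firstKind {n : ℕ} (ς : ℤˣ) (lam : Fin n → ℂ) (l : Fin n) (r ω : ℝ) : ℂ :=
  ∑' j : ℕ, (((ς : ℤ) : ℂ) * I ^ n) ^ j * coverPow r ω ((n : ℂ) * (-lam l + j))
    / ∏ k, Gamma (lam k - lam l + j + 1)

/-! ### The right hand side of the connection formula -/

/-- `S_l(μ, m) = ∏_{k ≠ l} (±i)^{m_l - m_k} / sin(π(μ_l - μ_k ± (m_l - m_k)/2))`,
the sign `±` being `ε` throughout. -/
def coeffS {n : ℕ} (ε : ℤˣ) (μ : Fin n → ℂ) (m : Fin n → ℤ) (l : Fin n) : ℂ :=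
  ∏ k ∈ Finset.univ.erase l,
    (((ε : ℤ) : ℂ) * I) ^ (m l - m k)
      / sin (Real.pi * (μ l - μ k + ((ε : ℤ) : ℂ) * (((m l - m k : ℤ) : ℂ) / 2)))

/-- `(2π²)^{n-1} ∑_l S_l(μ,m) J_l(2π z^{1/n}; +, μ + m/2) J_l(2π z̄^{1/n}; +, μ - m/2)` for
`z = x e^{iφ}`, where `z^{1/n} = x^{1/n} e^{iφ/n}` and `z̄^{1/n} = x^{1/n} e^{-iφ/n}`. -/
def connectionSum {n : ℕ} (ε : ℤˣ) (μ : Fin n → ℂ) (m : Fin n → ℤ) (x φ : ℝ) : ℂ :=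
  (2 * (Real.pi : ℂ) ^ 2) ^ (n - 1) *
    ∑ l, coeffS ε μ m l
      * (firstKind 1 (fun k => μ k + (m k : ℂ) / 2) l
            (2 * Real.pi * x ^ (1 / (n : ℝ))) (φ / n)
        * firstKind 1 (fun k => μ k - (m k : ℂ) / 2) l
            (2 * Real.pi * x ^ (1 / (n : ℝ))) (-(φ / n)))

end BesselKernel

end

/-!
The contour integral `j_(μ,m)(x)` is the sum of the residues of `G_(μ,m)(s) x^(-2s)` at its poles
`μ_l - |m_l|/2 - α`, `α ∈ ℕ`, which are simple for a generic index. Summing over the Fourier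
variable `κ` as well, the pairs `(κ, α)` become pairs `(j₁, j₂) ∈ ℕ²` by `j₁ - j₂ = m_l + κ` and
`min j₁ j₂ = α`. The pole is then `μ_l - (j₁ + j₂)/2`, its residue times `e^{iκφ}` factors, up to a
constant independent of `(j₁, j₂)`, into the `j₁`-th term of the series for
`J_l(2π z^{1/n}; +, μ + m/2)` and the `j₂`-th term of the one for
`J_l(2π z̄^{1/n}; +, μ - m/2)` (`residue_eq`), and the double series is the product of the two
(`connectionSum_eq_tsum`). The factorisation becomes visible after the reflection formula turns
`G_m(s)` into an entire function, symmetric in `m`, divided by `sin (π (s + m/2))`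
(`gammaFactor_eq`).

The residue expansion (`contourIntegral_eq_tsum`) comes from moving the half lines
of the contour to an abscissa `-(L + N)`, which leaves a line integral and the boundary of a
rectangle; the line integral tends to zero because `G_(μ,m)(s - 1)` is `G_(μ,m)(s)` divided by a
large polynomial. Convergence and the moving of the half lines rest on the sharp estimate
`‖Γ(a + iy)‖ ≍ |y|^(a-1) ‖Γ(1 + iy)‖` (`norm_Gamma_comparable`). Instead of Stirling's formula its
proof uses that `x ↦ ‖Γ(x + iy)‖ / Γ(x)` is logarithmically concave, which is visible factor by
factor in Euler's product (`norm_Gamma_div_logConcave`).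

For an arbitrary index both sides are limits along generic indices. Each contour integral is
continuous in the index (`tendsto_contourIntegral`). For large `|κ|` a fixed vertical line is an
admissible contour, on which the integrand is `O(1 / (1 + κ²))` uniformly near the given index
(`exists_bound_contourIntegral_shift`), so the series over `κ` converges absolutely and may be
passed to the limit. The same continuity shows that the integrals do not depend on the contours
(`contourIntegral_eq_of_admissible`).
-/

noncomputable section

namespace BesselKernel

/-! ### Rectangular contour integrals and residues -/

/-- The integral of `f` along the positively oriented boundary of the rectangle
`[a, b] × [c, d]`. -/
def rectIntegral (a b c d : ℝ) (f : ℂ → ℂ) : ℂ :=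
  (∫ u in a..b, f (u + c * I)) - (∫ u in a..b, f (u + d * I))
    + I * (∫ t in c..d, f (b + t * I)) - I * (∫ t in c..d, f (a + t * I))

theorem rectIntegral_eq_zero {a b c d : ℝ} {f : ℂ → ℂ}
    (hf : DifferentiableOn ℂ f (uIcc a b ×ℂ uIcc c d)) : rectIntegral a b c d f = 0 := by
  have h := Complex.integral_boundary_rect_eq_zero_of_differentiableOn f (a + c * I) (b + d * I)
    (by simpa using hf)
  simpa [rectIntegral] using h

theorem log_sub_log_neg_of_im_pos {w : ℂ} (hw : 0 < w.im) :
    log w - log (-w) = Real.pi * I := by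
  simp only [Complex.log, norm_neg, Complex.arg_neg_eq_arg_sub_pi_of_im_pos hw]
  push_cast
  ring

theorem log_neg_sub_log_of_im_neg {w : ℂ} (hw : w.im < 0) :
    log (-w) - log w = Real.pi * I := by
  simpa using log_sub_log_neg_of_im_pos (w := -w) (by simpa using hw)

/-- The basic residue. The principal logarithm of `s - p` is a primitive on three of the sides, that
of `p - s` on the left one; the two branches differ by `± π i` at the left corners. -/
theorem rectIntegral_inv_sub {a b c d : ℝ} {p : ℂ} (ha : a < p.re) (hb : p.re < b)
    (hc : c < p.im) (hd : p.im < d) :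
    rectIntegral a b c d (fun s => (s - p)⁻¹) = 2 * Real.pi * I := by
  have horiz : ∀ e : ℝ, e ≠ p.im → (∫ u in a..b, ((u + e * I - p : ℂ))⁻¹)
      = log (b + e * I - p) - log (a + e * I - p) := by
    intro e he
    have hmem : ∀ u : ℝ, (u + e * I - p : ℂ) ∈ slitPlane := fun u =>
      .inr (by simpa [sub_eq_zero] using he)
    refine intervalIntegral.integral_eq_sub_of_hasDerivAt
      (f := fun u : ℝ => log (u + e * I - p)) (fun u _ => ?_) ?_
    · have h1 : HasDerivAt (fun u : ℝ => (u + e * I - p : ℂ)) 1 u :=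
        ((hasDerivAt_id u).ofReal_comp.add_const _).sub_const _
      simpa using h1.clog_real (hmem u)
    · exact (Continuous.inv₀ (by fun_prop) fun u =>
        slitPlane_ne_zero (hmem u)).intervalIntegrable _ _
  have hright : I * (∫ t in c..d, ((b + t * I - p : ℂ))⁻¹)
      = log (b + d * I - p) - log (b + c * I - p) := by
    have hmem : ∀ t : ℝ, (b + t * I - p : ℂ) ∈ slitPlane := fun t => by
      left; simpa using hb
    rw [← intervalIntegral.integral_const_mul]
    refine intervalIntegral.integral_eq_sub_of_hasDerivAt
      (f := fun t : ℝ => log (b + t * I - p)) (fun t _ => ?_) ?_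
    · have h1 : HasDerivAt (fun t : ℝ => (b + t * I - p : ℂ)) I t := by
        simpa using (((hasDerivAt_id t).ofReal_comp.mul_const I).const_add (b : ℂ)).sub_const p
      simpa [div_eq_mul_inv] using h1.clog_real (hmem t)
    · exact (continuous_const.mul (Continuous.inv₀ (by fun_prop) fun t =>
        slitPlane_ne_zero (hmem t))).intervalIntegrable _ _
  have hleft : I * (∫ t in c..d, ((a + t * I - p : ℂ))⁻¹)
      = log (-(a + d * I - p)) - log (-(a + c * I - p)) := by
    have hmem : ∀ t : ℝ, (-(a + t * I - p) : ℂ) ∈ slitPlane := fun t => by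
      left; simpa using ha
    rw [← intervalIntegral.integral_const_mul]
    refine intervalIntegral.integral_eq_sub_of_hasDerivAt
      (f := fun t : ℝ => log (-(a + t * I - p))) (fun t _ => ?_) ?_
    · have h1 : HasDerivAt (fun t : ℝ => (-(a + t * I - p) : ℂ)) (-I) t := by
        have h2 := ((hasDerivAt_id t).ofReal_comp.mul_const I).const_add (a : ℂ)
        have h3 := (h2.sub_const p).neg
        rw [ofReal_one, one_mul] at h3
        exact h3
      have h2 := h1.clog_real (hmem t)
      rwa [neg_div_neg_eq, div_eq_mul_inv] at h2
    · exact (continuous_const.mul (Continuous.inv₀ (by fun_prop) fun t =>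
        neg_ne_zero.1 (slitPlane_ne_zero (hmem t)))).intervalIntegrable _ _
  have e1 := log_sub_log_neg_of_im_pos (w := a + d * I - p) (by simpa using hd)
  have e2 := log_neg_sub_log_of_im_neg (w := a + c * I - p) (by simpa using hc)
  rw [rectIntegral, horiz c hc.ne, horiz d hd.ne', hright, hleft]
  linear_combination e1 + e2

/-- The boundary of the rectangle `[a, b] × [c, d]`. -/
def rectBoundary (a b c d : ℝ) : Set ℂ :=
  {s | s.re ∈ Icc a b ∧ s.im ∈ Icc c d ∧ (s.re = a ∨ s.re = b ∨ s.im = c ∨ s.im = d)}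

theorem rectIntegral_add {a b c d : ℝ} (hab : a ≤ b) (hcd : c ≤ d) {f g : ℂ → ℂ}
    (hf : ContinuousOn f (rectBoundary a b c d)) (hg : ContinuousOn g (rectBoundary a b c d)) :
    rectIntegral a b c d (fun s => f s + g s)
      = rectIntegral a b c d f + rectIntegral a b c d g := by
  have h1 : ∀ e : ℝ, e = c ∨ e = d → ∀ f : ℂ → ℂ, ContinuousOn f (rectBoundary a b c d) →
      IntervalIntegrable (fun u : ℝ => f (u + e * I)) volume a b := by
    intro e he f hf
    refine ContinuousOn.intervalIntegrable (hf.comp (by fun_prop) fun u hu => ?_)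
    rw [uIcc_of_le hab] at hu
    rcases he with rfl | rfl <;> simp [rectBoundary, hu.1, hu.2, hcd]
  have h2 : ∀ e : ℝ, e = a ∨ e = b → ∀ f : ℂ → ℂ, ContinuousOn f (rectBoundary a b c d) →
      IntervalIntegrable (fun t : ℝ => f (e + t * I)) volume c d := by
    intro e he f hf
    refine ContinuousOn.intervalIntegrable (hf.comp (by fun_prop) fun u hu => ?_)
    rw [uIcc_of_le hcd] at hu
    rcases he with rfl | rfl <;> simp [rectBoundary, hu.1, hu.2, hab]
  simp only [rectIntegral]
  rw [intervalIntegral.integral_add (h1 c (.inl rfl) f hf) (h1 c (.inl rfl) g hg),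
    intervalIntegral.integral_add (h1 d (.inr rfl) f hf) (h1 d (.inr rfl) g hg),
    intervalIntegral.integral_add (h2 a (.inl rfl) f hf) (h2 a (.inl rfl) g hg),
    intervalIntegral.integral_add (h2 b (.inr rfl) f hf) (h2 b (.inr rfl) g hg)]
  ring

theorem rectIntegral_const_mul (a b c d : ℝ) (r : ℂ) (f : ℂ → ℂ) :
    rectIntegral a b c d (fun s => r * f s) = r * rectIntegral a b c d f := by
  simp only [rectIntegral, intervalIntegral.integral_const_mul]
  ring

theorem rectIntegral_congr {a b c d : ℝ} (hab : a ≤ b) (hcd : c ≤ d) {f g : ℂ → ℂ}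
    (h : EqOn f g (rectBoundary a b c d)) : rectIntegral a b c d f = rectIntegral a b c d g := by
  have h1 : ∀ e : ℝ, e = c ∨ e = d →
      (∫ u in a..b, f (u + e * I)) = ∫ u in a..b, g (u + e * I) := by
    intro e he
    refine intervalIntegral.integral_congr fun u hu => h ?_
    rw [uIcc_of_le hab] at hu
    rcases he with rfl | rfl <;> simp [rectBoundary, hu.1, hu.2, hcd]
  have h2 : ∀ e : ℝ, e = a ∨ e = b →
      (∫ t in c..d, f (e + t * I)) = ∫ t in c..d, g (e + t * I) := by
    intro e he
    refine intervalIntegral.integral_congr fun u hu => h ?_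
    rw [uIcc_of_le hcd] at hu
    rcases he with rfl | rfl <;> simp [rectBoundary, hu.1, hu.2, hab]
  rw [rectIntegral, rectIntegral, h1 c (.inl rfl), h1 d (.inr rfl), h2 a (.inl rfl),
    h2 b (.inr rfl)]

/-- The residue theorem for a rectangle and finitely many at most simple poles in its interior.
The poles are removed one at a time. -/
theorem rectIntegral_eq_sum_residues {a b c d : ℝ} (P : Finset ℂ) :
    ∀ {f : ℂ → ℂ} {r : ℂ → ℂ} {U : Set ℂ}, IsOpen U → Icc a b ×ℂ Icc c d ⊆ U →
    a ≤ b → c ≤ d →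
    DifferentiableOn ℂ f (U \ P) → (∀ p ∈ P, p ∈ Ioo a b ×ℂ Ioo c d) →
    (∀ p ∈ P, Tendsto (fun s => (s - p) * f s) (𝓝[≠] p) (𝓝 (r p))) →
    rectIntegral a b c d f = 2 * Real.pi * I * ∑ p ∈ P, r p := by
  classical
  induction P using Finset.induction_on with
  | empty =>
    intro f r U hU hsub hab hcd hf _ _
    rw [Finset.sum_empty, mul_zero]
    refine rectIntegral_eq_zero (hf.mono ?_)
    rw [uIcc_of_le hab, uIcc_of_le hcd]
    simpa using hsub
  | insert p P hp ih =>
    intro f r U hU hsub hab hcd hf hint hres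
    have hpin := hint p (Finset.mem_insert_self _ _)
    rw [mem_reProdIm] at hpin
    obtain ⟨⟨hp1, hp2⟩, hp3, hp4⟩ := hpin
    set g : ℂ → ℂ := fun s => f s - r p * (s - p)⁻¹ with hg
    set g' : ℂ → ℂ := Function.update g p (limUnder (𝓝[≠] p) g) with hg'
    have hPo : IsOpen (U \ (P : Set ℂ)) := hU.sdiff P.finite_toSet.isClosed
    have hpU : p ∈ U \ (P : Set ℂ) :=
      ⟨hsub (by rw [mem_reProdIm]; exact ⟨⟨hp1.le, hp2.le⟩, hp3.le, hp4.le⟩), by simpa using hp⟩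
    have hgd : DifferentiableOn ℂ g ((U \ (P : Set ℂ)) \ {p}) := by
      refine DifferentiableOn.sub (hf.mono ?_) ?_
      · rintro s ⟨⟨h1, h2⟩, h3⟩
        refine ⟨h1, ?_⟩
        simp only [Finset.coe_insert, Set.mem_insert_iff, not_or]
        exact ⟨h3, h2⟩
      · refine (DifferentiableOn.inv (by fun_prop) ?_).const_mul _
        intro s hs
        exact sub_ne_zero.2 hs.2
    have hlim : Tendsto (fun s => (s - p) * g s) (𝓝[≠] p) (𝓝 0) := by
      have h1 := (hres p (Finset.mem_insert_self _ _)).sub_const (r p)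
      rw [sub_self] at h1
      refine h1.congr' ?_
      filter_upwards [self_mem_nhdsWithin] with s hs
      have : s - p ≠ 0 := sub_ne_zero.2 hs
      simp only [hg]
      field_simp
    have ho : (fun s => g s - g p) =o[𝓝[≠] p] fun s => (s - p)⁻¹ := by
      rw [Asymptotics.isLittleO_iff_tendsto']
      · have h2 : Tendsto (fun s => (s - p) * g s - (s - p) * g p) (𝓝[≠] p) (𝓝 (0 - 0)) := by
          refine hlim.sub ?_
          have : Tendsto (fun s => (s - p) * g p) (𝓝 p) (𝓝 ((p - p) * g p)) :=
            Continuous.tendsto (by fun_prop) p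
          simpa using this.mono_left nhdsWithin_le_nhds
        rw [sub_zero] at h2
        refine h2.congr fun s => ?_
        rw [div_inv_eq_mul]; ring
      · filter_upwards [self_mem_nhdsWithin] with s hs h0
        exact absurd h0 (inv_ne_zero (sub_ne_zero.2 hs))
    have hd : DifferentiableOn ℂ g' (U \ (P : Set ℂ)) :=
      Complex.differentiableOn_update_limUnder_of_isLittleO (hPo.mem_nhds hpU) hgd ho
    have hb : EqOn f (fun s => g' s + r p * (s - p)⁻¹) (rectBoundary a b c d) := by
      rintro s ⟨-, -, hs⟩
      have hsp : s ≠ p := by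
        rintro rfl
        rcases hs with h | h | h | h
        · exact hp1.ne' h
        · exact hp2.ne h
        · exact hp3.ne' h
        · exact hp4.ne h
      simp [hg', hg, Function.update_of_ne hsp]
    have hbd : ∀ s ∈ rectBoundary a b c d, s ∈ U \ (P : Set ℂ) ∧ s ≠ p := by
      intro s hs
      have key : ∀ q ∈ insert p P, s ≠ q := by
        rintro q hq rfl
        have := hint s hq
        rw [mem_reProdIm] at this
        obtain ⟨⟨h1, h2⟩, h3, h4⟩ := this
        rcases hs.2.2 with h | h | h | h
        · exact h1.ne' h
        · exact h2.ne h
        · exact h3.ne' h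
        · exact h4.ne h
      refine ⟨⟨hsub (by rw [mem_reProdIm]; exact ⟨hs.1, hs.2.1⟩), fun h => ?_⟩,
        key p (Finset.mem_insert_self _ _)⟩
      exact key s (Finset.mem_insert_of_mem h) rfl
    have hg'c : ContinuousOn g' (rectBoundary a b c d) :=
      hd.continuousOn.mono fun s hs => (hbd s hs).1
    have hic : ContinuousOn (fun s => r p * (s - p)⁻¹) (rectBoundary a b c d) := by
      refine continuousOn_const.mul (ContinuousOn.inv₀ (by fun_prop) fun s hs => ?_)
      exact sub_ne_zero.2 (hbd s hs).2
    rw [rectIntegral_congr hab hcd hb, rectIntegral_add hab hcd hg'c hic, rectIntegral_const_mul,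
      rectIntegral_inv_sub hp1 hp2 hp3 hp4, Finset.sum_insert hp,
      ih (r := r) hU hsub hab hcd hd (fun q hq => hint q (Finset.mem_insert_of_mem hq)) ?_]
    · ring
    · intro q hq
      have hqp : q ≠ p := fun h => hp (h ▸ hq)
      have h1 := hres q (Finset.mem_insert_of_mem hq)
      have h2 : Tendsto (fun s => (s - q) * (r p * (s - p)⁻¹)) (𝓝[≠] q) (𝓝 0) := by
        have : ContinuousAt (fun s => (s - q) * (r p * (s - p)⁻¹)) q := by
          refine ContinuousAt.mul (by fun_prop) (continuousAt_const.mul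
            (ContinuousAt.inv₀ (by fun_prop) (sub_ne_zero.2 hqp)))
        simpa using this.tendsto.mono_left nhdsWithin_le_nhds
      have h3 := h1.sub h2
      rw [sub_zero] at h3
      refine h3.congr' ?_
      have : ∀ᶠ s in 𝓝[≠] q, s ≠ p :=
        nhdsWithin_le_nhds (isOpen_ne.mem_nhds hqp)
      filter_upwards [this] with s hs
      simp only [hg', hg, Function.update_of_ne hs]
      ring

/-! ### Moving the two infinite half lines of a contour -/

/-- Moving a vertical half line inside an upper half strip, for a function that decays at infinity
there. -/
theorem integral_half_strip {a b T : ℝ} {F : ℂ → ℂ}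
    (hd : ∀ s : ℂ, T ≤ s.im → DifferentiableAt ℂ F s)
    (ha : IntegrableOn (fun t : ℝ => F (a + t * I)) (Ioi T))
    (hb : IntegrableOn (fun t : ℝ => F (b + t * I)) (Ioi T))
    (h0 : Tendsto (fun R : ℝ => ∫ u in a..b, F (u + R * I)) atTop (𝓝 0)) :
    (∫ u in a..b, F (u + T * I)) + I * (∫ t in Ioi T, F (b + t * I))
      = I * ∫ t in Ioi T, F (a + t * I) := by
  have hA := intervalIntegral_tendsto_integral_Ioi T ha tendsto_id
  have hB := intervalIntegral_tendsto_integral_Ioi T hb tendsto_id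
  have hlim : Tendsto (fun R : ℝ => rectIntegral a b T R F) atTop
      (𝓝 ((∫ u in a..b, F (u + T * I)) - 0 + I * (∫ t in Ioi T, F (b + t * I))
        - I * ∫ t in Ioi T, F (a + t * I))) :=
    ((tendsto_const_nhds.sub h0).add (hB.const_mul I)).sub (hA.const_mul I)
  have hz : ∀ᶠ R : ℝ in atTop, rectIntegral a b T R F = 0 := by
    filter_upwards [eventually_ge_atTop T] with R hR
    refine rectIntegral_eq_zero fun s hs => (hd s ?_).differentiableWithinAt
    rw [mem_reProdIm, uIcc_of_le hR] at hs
    exact hs.2.1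
  have := tendsto_nhds_unique (hlim.congr' hz) tendsto_const_nhds
  linear_combination this

theorem tendsto_integral_horizontal {a b T C e : ℝ} {F : ℂ → ℂ} (he : e < 0)
    (hF : ∀ u ∈ uIcc a b, ∀ t : ℝ, T ≤ t → ‖F (u + t * I)‖ ≤ C * |t| ^ e) :
    Tendsto (fun R : ℝ => ∫ u in a..b, F (u + R * I)) atTop (𝓝 0) := by
  have h1 : Tendsto (fun R : ℝ => C * R ^ e * |b - a|) atTop (𝓝 0) := by
    have := (tendsto_rpow_neg_atTop (neg_pos.2 he)).const_mul C
    rw [neg_neg] at this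
    simpa using this.mul_const |b - a|
  refine squeeze_zero_norm' ?_ h1
  filter_upwards [eventually_ge_atTop T, eventually_ge_atTop 0] with R hR hR0
  refine intervalIntegral.norm_integral_le_of_norm_le_const fun u hu => ?_
  simpa [abs_of_nonneg hR0] using hF u (uIoc_subset_uIcc hu) R hR

theorem integrableOn_of_rpow_bound {f : ℝ → ℂ} {T C e : ℝ} (hT : 0 < T) (he : e < -1)
    (hc : ContinuousOn f (Ioi T)) (hf : ∀ t, T < t → ‖f t‖ ≤ C * t ^ e) :
    IntegrableOn f (Ioi T) := by
  refine Integrable.mono' ((integrableOn_Ioi_rpow_of_lt he hT).const_mul C)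
    (hc.aestronglyMeasurable measurableSet_Ioi) ?_
  filter_upwards [ae_restrict_mem measurableSet_Ioi] with t ht
  exact hf t ht

theorem integrableOn_vertical {u T C e : ℝ} {F : ℂ → ℂ} (hT : 0 < T) (he : e < -1)
    (hd : ∀ s : ℂ, T ≤ |s.im| → DifferentiableAt ℂ F s)
    (hF : ∀ t : ℝ, T ≤ |t| → ‖F (u + t * I)‖ ≤ C * |t| ^ e) :
    IntegrableOn (fun t : ℝ => F (u + t * I)) (Ioi T) := by
  refine integrableOn_of_rpow_bound (C := C) hT he (fun t ht => ?_) fun t ht => ?_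
  · have h : ContinuousAt F (u + t * I) := by
      refine (hd _ ?_).continuousAt
      simpa using (le_of_lt ht).trans (le_abs_self t)
    exact (ContinuousAt.comp (f := fun t : ℝ => (u + t * I : ℂ)) h
      (by fun_prop)).continuousWithinAt
  · have h := hF t (ht.le.trans (le_abs_self t))
    rwa [abs_of_pos (hT.trans ht)] at h

theorem contour_tail_shift {σ σ' T C e : ℝ} {F : ℂ → ℂ} (hT : 0 < T) (he : e < -1)
    (hd : ∀ s : ℂ, T ≤ |s.im| → DifferentiableAt ℂ F s)
    (hF : ∀ u ∈ uIcc σ' σ, ∀ t : ℝ, T ≤ |t| → ‖F (u + t * I)‖ ≤ C * |t| ^ e) :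
    (∫ u in σ'..σ, F (u + T * I)) + I * (∫ t in Ioi T, F (σ + t * I))
      = I * ∫ t in Ioi T, F (σ' + t * I) :=
  integral_half_strip (fun s hs => hd s (hs.trans (le_abs_self _)))
    (integrableOn_vertical hT he hd (hF _ left_mem_uIcc))
    (integrableOn_vertical hT he hd (hF _ right_mem_uIcc))
    (tendsto_integral_horizontal (T := T) (by linarith) fun u hu t ht =>
      hF u hu t (ht.trans (le_abs_self t)))

/-- The lower half strip, reduced to the upper one by `s ↦ -s`. -/
theorem contour_tail_shift_neg {σ σ' T C e : ℝ} {F : ℂ → ℂ} (hT : 0 < T) (he : e < -1)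
    (hd : ∀ s : ℂ, T ≤ |s.im| → DifferentiableAt ℂ F s)
    (hF : ∀ u ∈ uIcc σ' σ, ∀ t : ℝ, T ≤ |t| → ‖F (u + t * I)‖ ≤ C * |t| ^ e) :
    (∫ u in σ'..σ, F (u - T * I)) + I * (∫ t in Iic (-T), F (σ' + t * I))
      = I * ∫ t in Iic (-T), F (σ + t * I) := by
  have key : ∀ v t : ℝ, -(((-v : ℝ) : ℂ) + (t : ℂ) * I) = v + ((-t : ℝ) : ℂ) * I := by
    intro v t
    push_cast
    ring
  have down := contour_tail_shift (σ := -σ') (σ' := -σ) (T := T) (C := C) (F := fun s => F (-s))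
    hT he
    (fun s hs => (hd (-s) (by simpa using hs)).comp s differentiable_neg.differentiableAt)
    (fun u hu t ht => by
      have hu' : -u ∈ uIcc σ' σ := by
        rw [mem_uIcc] at hu ⊢
        rcases hu with h | h
        · left; constructor <;> linarith [h.1, h.2]
        · right; constructor <;> linarith [h.1, h.2]
      have h := hF (-u) hu' (-t) (by rwa [abs_neg])
      rw [abs_neg, ← key, neg_neg] at h
      exact h)
  have hlow : ∀ v : ℝ, (∫ t in Ioi T, F (-(((-v : ℝ) : ℂ) + t * I)))
      = ∫ t in Iic (-T), F (v + t * I) := by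
    intro v
    rw [← integral_comp_neg_Ioi T (fun t : ℝ => F (v + t * I))]
    simp only [key]
  rw [hlow, hlow] at down
  have hbot : (∫ u in -σ..-σ', F (-((u : ℂ) + T * I))) = ∫ u in σ'..σ, F (u - T * I) := by
    have h := intervalIntegral.integral_comp_neg (a := -σ) (b := -σ')
      (fun u : ℝ => F (u - T * I))
    rw [neg_neg, neg_neg] at h
    rw [← h]
    refine intervalIntegral.integral_congr fun u _ => ?_
    simp only [ofReal_neg, neg_add, sub_eq_add_neg]
  rwa [hbot] at down

/-- A contour integral only depends on the abscissa of the two half lines through the strip in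
which the integrand decays. -/
theorem contourIntegral_shift {σ σ' ρ T C e : ℝ} {F : ℂ → ℂ} (hT : 0 < T) (he : e < -1)
    (hd : ∀ s : ℂ, T ≤ |s.im| → DifferentiableAt ℂ F s)
    (hF : ∀ u ∈ uIcc σ' σ, ∀ t : ℝ, T ≤ |t| → ‖F (u + t * I)‖ ≤ C * |t| ^ e) :
    contourIntegral σ ρ T F = contourIntegral σ' ρ T F := by
  have up := contour_tail_shift hT he hd hF
  have down := contour_tail_shift_neg hT he hd hF
  have hii : ∀ p q : ℝ, IntervalIntegrable (fun u : ℝ => F (u + T * I)) volume p q := fun p q => by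
    refine Continuous.intervalIntegrable (continuous_iff_continuousAt.2 fun u => ?_) _ _
    have h : ContinuousAt F (u + T * I) := (hd _ (by simp [le_abs_self])).continuousAt
    exact ContinuousAt.comp (f := fun u : ℝ => (u + T * I : ℂ)) h (by fun_prop)
  have hij : ∀ p q : ℝ, IntervalIntegrable (fun u : ℝ => F (u - T * I)) volume p q := fun p q => by
    refine Continuous.intervalIntegrable (continuous_iff_continuousAt.2 fun u => ?_) _ _
    have h : ContinuousAt F (u - T * I) := (hd _ (by simp [le_abs_self])).continuousAt
    exact ContinuousAt.comp (f := fun u : ℝ => (u - T * I : ℂ)) h (by fun_prop)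
  have a1 := intervalIntegral.integral_add_adjacent_intervals (hij σ' σ) (hij σ ρ)
  have a2 := intervalIntegral.integral_add_adjacent_intervals (hii ρ σ') (hii σ' σ)
  simp only [contourIntegral, integral_mul_const]
  linear_combination up - down + a1 - a2

/-- A contour that is a bump on a vertical line is the line plus the boundary of a rectangle. -/
theorem contourIntegral_eq_line_add_rect {a ρ T : ℝ} {F : ℂ → ℂ}
    (hint : Integrable fun t : ℝ => F (a + t * I)) :
    contourIntegral a ρ T F
      = I * (∫ t : ℝ, F (a + t * I)) + rectIntegral a ρ (-T) T F := by
  have h1 := intervalIntegral.integral_interval_add_Ioi' (μ := volume) (a := -T) (b := T)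
    hint.intervalIntegrable hint.integrableOn
  have h2 := intervalIntegral.integral_Iic_add_Ioi (b := -T) hint.integrableOn hint.integrableOn
  have h3 : (∫ u in ρ..a, F (u + T * I)) = - ∫ u in a..ρ, F (u + T * I) :=
    intervalIntegral.integral_symm _ _
  simp only [contourIntegral, rectIntegral, integral_mul_const, intervalIntegral.integral_mul_const,
    ofReal_neg, neg_mul, ← sub_eq_add_neg]
  rw [← h2, ← h1, h3]
  ring

/-! ### Estimates for the Gamma function on vertical lines -/

/-- Logarithmic convexity of `u ↦ 1 + y² / u²` on `(0, ∞)`. -/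
theorem one_add_sq_div_sq_logConvex {u y θ : ℝ} (hu : 0 < u) (h0 : 0 ≤ θ) (h1 : θ ≤ 1) :
    1 + y ^ 2 / (u + θ) ^ 2
      ≤ (1 + y ^ 2 / u ^ 2) ^ (1 - θ) * (1 + y ^ 2 / (u + 1) ^ 2) ^ θ := by
  set A := y ^ 2 / u ^ 2 with hA
  set B := y ^ 2 / (u + 1) ^ 2 with hB
  have hA0 : 0 ≤ A := by positivity
  have hB0 : 0 ≤ B := by positivity
  have hθ : 0 ≤ 1 - θ := by linarith
  have hAM : u ^ (1 - θ) * (u + 1) ^ θ ≤ u + θ := by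
    have := Real.geom_mean_le_arith_mean2_weighted hθ h0 hu.le (by linarith : 0 ≤ u + 1) (by ring)
    linarith
  -- concavity of the logarithm, `u ^ (1 - θ) * (u + 1) ^ θ ≤ u + θ`, bounds the left quotient by
  -- the geometric mean of `A` and `B`
  have hmid : y ^ 2 / (u + θ) ^ 2 ≤ A ^ (1 - θ) * B ^ θ := by
    have e1 : A ^ (1 - θ) * B ^ θ = y ^ 2 / (u ^ (1 - θ) * (u + 1) ^ θ) ^ 2 := by
      rw [hA, hB, Real.div_rpow (by positivity) (by positivity),
        Real.div_rpow (by positivity) (by positivity), div_mul_div_comm,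
        ← Real.rpow_add_of_nonneg (by positivity) hθ h0, mul_pow,
        ← Real.rpow_natCast_mul hu.le, ← Real.rpow_natCast_mul (by linarith : 0 ≤ u + 1),
        ← Real.rpow_mul_natCast hu.le, ← Real.rpow_mul_natCast (by linarith : 0 ≤ u + 1)]
      simp [mul_comm]
    rw [e1]
    exact div_le_div_of_nonneg_left (sq_nonneg y) (by positivity)
      (pow_le_pow_left₀ (by positivity) hAM 2)
  clear_value A B
  -- Hölder's inequality `1 + A ^ (1 - θ) * B ^ θ ≤ (1 + A) ^ (1 - θ) * (1 + B) ^ θ`, from two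
  -- weighted means whose right-hand sides add up to `1`
  have hg1 := Real.geom_mean_le_arith_mean2_weighted hθ h0 (p₁ := 1 / (1 + A)) (p₂ := 1 / (1 + B))
    (by positivity) (by positivity) (by ring)
  have hg2 := Real.geom_mean_le_arith_mean2_weighted hθ h0 (p₁ := A / (1 + A)) (p₂ := B / (1 + B))
    (by positivity) (by positivity) (by ring)
  rw [Real.div_rpow (by positivity) (by positivity), Real.div_rpow (by positivity) (by positivity),
    div_mul_div_comm] at hg1 hg2
  have hsum : (1 - θ) * (1 / (1 + A)) + θ * (1 / (1 + B))
      + ((1 - θ) * (A / (1 + A)) + θ * (B / (1 + B))) = 1 := by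
    field_simp
    ring
  have hP : 0 < (1 + A) ^ (1 - θ) * (1 + B) ^ θ := by positivity
  have : (1 + A ^ (1 - θ) * B ^ θ) / ((1 + A) ^ (1 - θ) * (1 + B) ^ θ) ≤ 1 := by
    rw [add_div]
    simp only [Real.one_rpow, one_mul] at hg1
    linarith
  rw [div_le_one hP] at this
  linarith

theorem norm_ofReal_add_ofReal_mul_I (u y : ℝ) : ‖(u + y * I : ℂ)‖ = √(u ^ 2 + y ^ 2) :=
  norm_add_mul_I u y

/-- The factors of the Euler product of `‖Γ (u + iy)‖ / Γ u` are logarithmically concave in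
`u`. -/
theorem div_norm_logConcave {u y θ : ℝ} (hu : 0 < u) (h0 : 0 ≤ θ) (h1 : θ ≤ 1) :
    (u / ‖(u + y * I : ℂ)‖) ^ (1 - θ) * ((u + 1) / ‖((u + 1 : ℝ) + y * I : ℂ)‖) ^ θ
      ≤ (u + θ) / ‖((u + θ : ℝ) + y * I : ℂ)‖ := by
  have key : ∀ v : ℝ, 0 < v → v / ‖(v + y * I : ℂ)‖ = (1 + y ^ 2 / v ^ 2) ^ (-(1 / 2) : ℝ) := by
    intro v hv
    rw [norm_ofReal_add_ofReal_mul_I, Real.rpow_neg (by positivity), ← Real.sqrt_eq_rpow]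
    have : v ^ 2 + y ^ 2 = v ^ 2 * (1 + y ^ 2 / v ^ 2) := by field_simp
    rw [this, Real.sqrt_mul (by positivity), Real.sqrt_sq hv.le]
    field_simp
  have hv : 0 < u + θ := by linarith
  rw [key u hu, key (u + 1) (by linarith), key (u + θ) hv, ← Real.rpow_mul (by positivity),
    ← Real.rpow_mul (by positivity), mul_comm (-(1 / 2)) (1 - θ), mul_comm (-(1 / 2)) θ,
    Real.rpow_mul (by positivity), Real.rpow_mul (by positivity),
    ← Real.mul_rpow (by positivity) (by positivity)]
  exact Real.rpow_le_rpow_of_nonpos (by positivity) (one_add_sq_div_sq_logConvex hu h0 h1)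
    (by norm_num)

theorem norm_GammaSeq_div {x y : ℝ} (hx : 0 < x) {N : ℕ} (hN : N ≠ 0) :
    ‖Complex.GammaSeq (x + y * I) N‖ / Real.GammaSeq x N
      = ∏ j ∈ Finset.range (N + 1), ((x + j) / ‖((x + j : ℝ) + y * I : ℂ)‖) := by
  have hNpos : (0 : ℝ) < N := by exact_mod_cast Nat.pos_of_ne_zero hN
  have h1 : ‖((N : ℕ) : ℂ) ^ (x + y * I : ℂ)‖ = (N : ℝ) ^ x := by
    have := Complex.norm_cpow_eq_rpow_re_of_pos hNpos (x + y * I)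
    simpa using this
  rw [Complex.GammaSeq, Real.GammaSeq, norm_div, norm_mul, h1, Complex.norm_natCast, norm_prod,
    Finset.prod_div_distrib]
  have h2 : ∀ j : ℕ, (x + y * I + j : ℂ) = ((x + j : ℝ) : ℂ) + y * I := by
    intro j; push_cast; ring
  simp only [h2]
  have h3 : (0 : ℝ) < N.factorial := by positivity
  have h4 : (0 : ℝ) < (N : ℝ) ^ x := by positivity
  field_simp

/-- Logarithmic concavity of `x ↦ ‖Γ (x + iy)‖ / Γ x`. -/
theorem norm_Gamma_div_logConcave {x y θ : ℝ} (hx : 0 < x) (h0 : 0 ≤ θ) (h1 : θ ≤ 1) :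
    (‖Gamma (x + y * I)‖ / Real.Gamma x) ^ (1 - θ)
        * (‖Gamma ((x + 1 : ℝ) + y * I)‖ / Real.Gamma (x + 1)) ^ θ
      ≤ ‖Gamma ((x + θ : ℝ) + y * I)‖ / Real.Gamma (x + θ) := by
  have lim : ∀ v : ℝ, 0 < v → Tendsto
      (fun N => ‖Complex.GammaSeq (v + y * I) N‖ / Real.GammaSeq v N) atTop
      (𝓝 (‖Gamma (v + y * I)‖ / Real.Gamma v)) := fun v hv =>
    (Complex.GammaSeq_tendsto_Gamma _).norm.div (Real.GammaSeq_tendsto_Gamma v)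
      (Real.Gamma_pos_of_pos hv).ne'
  have l1 := ((lim x hx).rpow_const (p := 1 - θ) (.inr (by linarith))).mul
    ((lim (x + 1) (by linarith)).rpow_const (p := θ) (.inr h0))
  refine le_of_tendsto_of_tendsto l1 (lim (x + θ) (by linarith)) ?_
  filter_upwards [eventually_ne_atTop 0] with N hN
  rw [norm_GammaSeq_div hx hN, norm_GammaSeq_div (by linarith) hN,
    norm_GammaSeq_div (by linarith) hN,
    ← Real.finsetProd_rpow _ _ (fun j _ => by positivity),
    ← Real.finsetProd_rpow _ _ (fun j _ => by positivity), ← Finset.prod_mul_distrib]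
  refine Finset.prod_le_prod (fun j _ => by positivity) fun j _ => ?_
  have := div_norm_logConcave (u := x + j) (y := y) (by positivity) h0 h1
  rwa [add_right_comm x (j : ℝ) 1, add_right_comm x (j : ℝ) θ] at this

theorem norm_Gamma_add_one {x y : ℝ} (h : (x + y * I : ℂ) ≠ 0) :
    ‖Gamma ((x + 1 : ℝ) + y * I)‖ = ‖(x + y * I : ℂ)‖ * ‖Gamma (x + y * I)‖ := by
  rw [← norm_mul, ← Complex.Gamma_add_one _ h]
  congr 2
  push_cast
  ring

/-- A form of Gautschi's inequality, from the logarithmic convexity of the real Gamma function. -/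
theorem Gamma_mul_rpow_le {x θ : ℝ} (hx : 1 ≤ x) (h0 : 0 ≤ θ) (h1 : θ ≤ 1) :
    Real.Gamma x * x ^ θ ≤ 2 * Real.Gamma (x + θ) := by
  have hx0 : 0 < x := by linarith
  have hG := Real.Gamma_pos_of_pos hx0
  have hGθ := Real.Gamma_pos_of_pos (by linarith : 0 < x + θ)
  rcases h0.eq_or_lt with rfl | h0'
  · simp; linarith
  rcases h1.eq_or_lt with rfl | h1'
  · rw [Real.Gamma_add_one hx0.ne', Real.rpow_one]; nlinarith
  have hc := Real.Gamma_mul_add_mul_le_rpow_Gamma_mul_rpow_Gamma (s := x + θ) (t := x + θ + 1)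
    (a := θ) (b := 1 - θ) (by linarith) (by linarith) h0' (by linarith) (by ring)
  rw [show θ * (x + θ) + (1 - θ) * (x + θ + 1) = x + 1 by ring, Real.Gamma_add_one hx0.ne',
    Real.Gamma_add_one (by linarith : x + θ ≠ 0), Real.mul_rpow (by linarith) hGθ.le] at hc
  have e1 : Real.Gamma (x + θ) ^ θ * ((x + θ) ^ (1 - θ) * Real.Gamma (x + θ) ^ (1 - θ))
      = Real.Gamma (x + θ) * (x + θ) ^ (1 - θ) := by
    rw [mul_left_comm, ← Real.rpow_add hGθ]
    norm_num [mul_comm]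
  rw [e1] at hc
  have h3 : (x + θ) ^ (1 - θ) ≤ 2 * x ^ (1 - θ) := by
    calc (x + θ) ^ (1 - θ) ≤ (2 * x) ^ (1 - θ) :=
          Real.rpow_le_rpow (by linarith) (by linarith) (by linarith)
      _ = 2 ^ (1 - θ) * x ^ (1 - θ) := Real.mul_rpow (by norm_num) hx0.le
      _ ≤ 2 * x ^ (1 - θ) := by
          gcongr
          calc (2 : ℝ) ^ (1 - θ) ≤ 2 ^ (1 : ℝ) :=
                Real.rpow_le_rpow_of_exponent_le (by norm_num) (by linarith)
            _ = 2 := Real.rpow_one 2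
  have hxx : x = x ^ θ * x ^ (1 - θ) := by
    rw [← Real.rpow_add hx0]; norm_num
  have hpos : 0 < x ^ (1 - θ) := by positivity
  have h4 : x ^ (1 - θ) * (Real.Gamma x * x ^ θ) ≤ x ^ (1 - θ) * (2 * Real.Gamma (x + θ)) := by
    calc x ^ (1 - θ) * (Real.Gamma x * x ^ θ) = (x ^ θ * x ^ (1 - θ)) * Real.Gamma x := by ring
      _ = x * Real.Gamma x := by rw [← hxx]
      _ ≤ Real.Gamma (x + θ) * (x + θ) ^ (1 - θ) := hc
      _ ≤ Real.Gamma (x + θ) * (2 * x ^ (1 - θ)) := by gcongr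
      _ = _ := by ring
  exact le_of_mul_le_mul_left h4 hpos

/-- The sharp comparison of two values of the Gamma function on a horizontal segment of length at
most `1`, uniform in the imaginary part. -/
theorem norm_Gamma_mul_rpow_le {x y θ : ℝ} (hx : 1 ≤ x) (h0 : 0 ≤ θ) (h1 : θ ≤ 1) :
    ‖Gamma (x + y * I)‖ * ‖(x + y * I : ℂ)‖ ^ θ ≤ 2 * ‖Gamma ((x + θ : ℝ) + y * I)‖ := by
  have hx0 : 0 < x := by linarith
  have hG := Real.Gamma_pos_of_pos hx0
  have hGθ := Real.Gamma_pos_of_pos (by linarith : 0 < x + θ)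
  have hz : (x + y * I : ℂ) ≠ 0 := by
    intro h
    have := congrArg Complex.re h
    simp at this
    linarith
  have hn : 0 < ‖(x + y * I : ℂ)‖ := norm_pos_iff.2 hz
  have hg : 0 < ‖Gamma (x + y * I)‖ :=
    norm_pos_iff.2 (Complex.Gamma_ne_zero_of_re_pos (by simpa using hx0))
  have h := norm_Gamma_div_logConcave (y := y) hx0 h0 h1
  rw [norm_Gamma_add_one hz, Real.Gamma_add_one hx0.ne', mul_div_mul_comm,
    Real.mul_rpow (by positivity) (by positivity), mul_left_comm,
    ← Real.rpow_add (by positivity), sub_add_cancel, Real.rpow_one,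
    Real.div_rpow hn.le hx0.le, div_mul_div_comm, div_le_div_iff₀ (by positivity) hGθ] at h
  have h2 := Gamma_mul_rpow_le hx h0 h1
  have h3 : ‖(x + y * I : ℂ)‖ ^ θ * ‖Gamma (x + y * I)‖ * Real.Gamma (x + θ)
      ≤ (2 * ‖Gamma ((x + θ : ℝ) + y * I)‖) * Real.Gamma (x + θ) := by
    refine h.trans ?_
    nlinarith [norm_nonneg (Gamma ((x + θ : ℝ) + y * I))]
  have := le_of_mul_le_mul_right h3 hGθ
  linarith

theorem pow_mul_norm_Gamma_le {x y : ℝ} (hx : 1 ≤ x) (N : ℕ) :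
    ‖(x + y * I : ℂ)‖ ^ N * ‖Gamma (x + y * I)‖ ≤ ‖Gamma ((x + N : ℝ) + y * I)‖ := by
  induction N with
  | zero => simp
  | succ N ih =>
    have hz : ((x + N : ℝ) + y * I : ℂ) ≠ 0 := by
      intro h
      have := congrArg Complex.re h
      simp at this
      have : (0 : ℝ) ≤ N := N.cast_nonneg
      linarith
    have e := norm_Gamma_add_one hz
    rw [add_assoc] at e
    rw [Nat.cast_add_one, e, pow_succ', mul_assoc]
    refine mul_le_mul ?_ ih (by positivity) (by positivity)
    rw [norm_ofReal_add_ofReal_mul_I, norm_ofReal_add_ofReal_mul_I]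
    refine Real.sqrt_le_sqrt ?_
    have : (0 : ℝ) ≤ N := N.cast_nonneg
    nlinarith

/-- A comparison whose constant does not depend on `x`, for abscissas at distance at least `4`. It
carries the estimates that are uniform in the Fourier variable. -/
theorem norm_Gamma_mul_pow_four_le {x y e : ℝ} (hx : 1 ≤ x) (he : 4 ≤ e) :
    ‖(x + y * I : ℂ)‖ ^ 4 * ‖Gamma (x + y * I)‖ ≤ 2 * ‖Gamma ((x + e : ℝ) + y * I)‖ := by
  have he0 : 0 ≤ e := by linarith
  set N := ⌊e⌋₊ with hN
  have hN4 : 4 ≤ N := Nat.le_floor (by exact_mod_cast he)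
  have hNle : (N : ℝ) ≤ e := Nat.floor_le he0
  have hlt : e < N + 1 := Nat.lt_floor_add_one e
  have h1le : ∀ v : ℝ, 1 ≤ v → 1 ≤ ‖(v + y * I : ℂ)‖ := by
    intro v hv
    have := Complex.abs_re_le_norm (v + y * I : ℂ)
    simp only [add_re, ofReal_re, mul_re, I_re, mul_zero, ofReal_im, I_im, mul_one, sub_self,
      add_zero] at this
    exact hv.trans ((le_abs_self v).trans this)
  have hxN : 1 ≤ x + N := by
    have : (0 : ℝ) ≤ N := N.cast_nonneg
    linarith
  have hA := norm_Gamma_mul_rpow_le (x := x + N) (y := y) (θ := e - N) hxN (by linarith)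
    (by linarith)
  rw [show x + N + (e - N) = x + e by ring] at hA
  have hB := pow_mul_norm_Gamma_le (y := y) hx N
  have hC : ‖Gamma ((x + N : ℝ) + y * I)‖
      ≤ ‖Gamma ((x + N : ℝ) + y * I)‖ * ‖((x + N : ℝ) + y * I : ℂ)‖ ^ (e - N) :=
    le_mul_of_one_le_right (norm_nonneg _) (Real.one_le_rpow (h1le _ hxN) (by linarith))
  have hD : ‖(x + y * I : ℂ)‖ ^ 4 * ‖Gamma (x + y * I)‖
      ≤ ‖(x + y * I : ℂ)‖ ^ N * ‖Gamma (x + y * I)‖ := by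
    gcongr
    exact h1le x hx
  linarith

/-- On `|y| ≥ δ` the quotient `‖Γ (a + iy)‖ / ‖Γ (1 + iy)‖` is comparable with `|y| ^ (a - 1)`; here
for `a` in the unit interval that starts at `1 + N`. -/
theorem norm_Gamma_comparable_unit {δ : ℝ} (hδ : 0 < δ) (N : ℤ) :
    ∃ C : ℝ, 1 ≤ C ∧ ∀ θ y : ℝ, 0 ≤ θ → θ ≤ 1 → δ ≤ |y| →
      ‖Gamma ((1 + N + θ : ℝ) + y * I)‖ ≤ C * |y| ^ (N + θ : ℝ) * ‖Gamma (1 + y * I)‖ ∧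
      |y| ^ (N + θ : ℝ) * ‖Gamma (1 + y * I)‖ ≤ C * ‖Gamma ((1 + N + θ : ℝ) + y * I)‖ := by
  -- for bounded `a` and `|y| ≥ δ` the norm of `a + iy` is comparable with `|y|`
  have hlow : ∀ a y : ℝ, |y| ≤ ‖(a + y * I : ℂ)‖ := fun a y => by
    simpa using Complex.abs_im_le_norm (a + y * I : ℂ)
  have hup : ∀ a y : ℝ, δ ≤ |y| → ‖(a + y * I : ℂ)‖ ≤ (|a| / δ + 1) * |y| := by
    intro a y hy
    have h1 : ‖(a + y * I : ℂ)‖ ≤ |a| + |y| := by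
      refine (norm_add_le _ _).trans ?_
      simp
    have h2 : |a| ≤ |a| / δ * |y| := by
      rw [div_mul_eq_mul_div, le_div_iff₀ hδ]
      exact mul_le_mul_of_nonneg_left hy (abs_nonneg a)
    linarith
  have hne : ∀ a y : ℝ, δ ≤ |y| → (a + y * I : ℂ) ≠ 0 := fun a y hy =>
    norm_pos_iff.1 ((hδ.trans_le hy).trans_le (hlow a y))
  induction N using Int.induction_on with
  | zero =>
    refine ⟨2 * (1 / δ + 1), by have : 0 < 1 / δ := by positivity
                                linarith, fun θ y h0 h1 hy => ?_⟩
    have hy0 : 0 < |y| := hδ.trans_le hy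
    simp only [Int.cast_zero, add_zero, zero_add]
    have hK : (1 : ℝ) ≤ 1 / δ + 1 := by
      have : 0 < 1 / δ := by positivity
      linarith
    -- the upper bound compares the abscissas `1 + θ` and `2`, the lower one `1` and `1 + θ`
    constructor
    · have hA := norm_Gamma_mul_rpow_le (x := 1 + θ) (y := y) (θ := 1 - θ) (by linarith)
        (by linarith) (by linarith)
      rw [show 1 + θ + (1 - θ) = (1 : ℝ) + 1 by ring, norm_Gamma_add_one (hne 1 y hy)] at hA
      have hB : ‖Gamma ((1 + θ : ℝ) + y * I)‖ * |y| ^ (1 - θ)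
          ≤ 2 * ((|1| / δ + 1) * |y| * ‖Gamma ((1 : ℝ) + y * I)‖) := by
        refine le_trans ?_ (hA.trans ?_)
        · gcongr
          exact hlow _ _
        · gcongr
          exact hup 1 y hy
      have hC : |y| = |y| ^ θ * |y| ^ (1 - θ) := by
        rw [← Real.rpow_add hy0]; norm_num
      have hp : 0 < |y| ^ (1 - θ) := by positivity
      refine le_of_mul_le_mul_right (hB.trans (le_of_eq ?_)) hp
      rw [abs_one, ofReal_one]
      nth_rewrite 1 [hC]
      ring
    · have hA := norm_Gamma_mul_rpow_le (x := 1) (y := y) le_rfl h0 h1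
      rw [ofReal_one] at hA
      have hB : |y| ^ θ ≤ ‖(1 + y * I : ℂ)‖ ^ θ :=
        Real.rpow_le_rpow hy0.le (by simpa using hlow 1 y) h0
      have hG := norm_nonneg (Gamma ((1 + θ : ℝ) + y * I))
      calc |y| ^ θ * ‖Gamma (1 + y * I)‖
          ≤ ‖(1 + y * I : ℂ)‖ ^ θ * ‖Gamma (1 + y * I)‖ := by gcongr
        _ ≤ 2 * ‖Gamma ((1 + θ : ℝ) + y * I)‖ := by linarith
        _ ≤ _ := by nlinarith
  | succ N ih =>
    obtain ⟨C, hC1, hC⟩ := ih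
    have hK : (1 : ℝ) ≤ (N + 2) / δ + 1 := by
      have : 0 < (N + 2 : ℝ) / δ := by positivity
      linarith
    refine ⟨C * ((N + 2) / δ + 1), one_le_mul_of_one_le_of_one_le hC1 hK,
      fun θ y h0 h1 hy => ?_⟩
    have hy0 : 0 < |y| := hδ.trans_le hy
    obtain ⟨h2, h3⟩ := hC θ y h0 h1 hy
    have e1 : (((1 + ((N : ℤ) + 1 : ℤ) + θ : ℝ)) : ℝ) = (1 + (N : ℤ) + θ : ℝ) + 1 := by
      push_cast; ring
    have e2 : |y| ^ (((N : ℤ) + 1 : ℤ) + θ : ℝ) = |y| * |y| ^ ((N : ℤ) + θ : ℝ) := by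
      rw [← Real.rpow_one_add' hy0.le (by push_cast; positivity)]
      congr 1; push_cast; ring
    rw [e1, norm_Gamma_add_one (hne _ y hy), e2]
    have h4 := hup (1 + (N : ℤ) + θ) y hy
    have h5 : |(1 + (N : ℤ) + θ : ℝ)| / δ + 1 ≤ (N + 2) / δ + 1 := by
      gcongr
      rw [abs_of_nonneg (by push_cast; positivity)]
      push_cast; linarith
    constructor
    · calc _ ≤ ((N + 2) / δ + 1) * |y| * (C * |y| ^ ((N : ℤ) + θ : ℝ) * ‖Gamma (1 + y * I)‖) := by
            refine mul_le_mul (h4.trans ?_) h2 (norm_nonneg _) (by positivity)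
            gcongr
        _ = _ := by ring
    · calc _ = |y| * (|y| ^ ((N : ℤ) + θ : ℝ) * ‖Gamma (1 + y * I)‖) := by ring
        _ ≤ ‖((1 + (N : ℤ) + θ : ℝ) + y * I : ℂ)‖ *
              (C * ‖Gamma ((1 + (N : ℤ) + θ : ℝ) + y * I)‖) :=
            mul_le_mul (hlow _ y) h3 (by positivity) (norm_nonneg _)
        _ = 1 * (C * (‖((1 + (N : ℤ) + θ : ℝ) + y * I : ℂ)‖ *
              ‖Gamma ((1 + (N : ℤ) + θ : ℝ) + y * I)‖)) := by ring
        _ ≤ ((N + 2) / δ + 1) * (C * (‖((1 + (N : ℤ) + θ : ℝ) + y * I : ℂ)‖ *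
              ‖Gamma ((1 + (N : ℤ) + θ : ℝ) + y * I)‖)) := by gcongr
        _ = _ := by ring
  | pred N ih =>
    obtain ⟨C, hC1, hC⟩ := ih
    have hK : (1 : ℝ) ≤ (N + 2) / δ + 1 := by
      have : 0 < (N + 2 : ℝ) / δ := by positivity
      linarith
    refine ⟨C * ((N + 2) / δ + 1), one_le_mul_of_one_le_of_one_le hC1 hK,
      fun θ y h0 h1 hy => ?_⟩
    have hy0 : 0 < |y| := hδ.trans_le hy
    obtain ⟨h2, h3⟩ := hC θ y h0 h1 hy
    set b : ℝ := 1 + ((-(N : ℤ) - 1 : ℤ) : ℝ) + θ with hb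
    have e1 : (1 + (-(N : ℤ) : ℤ) + θ : ℝ) = b + 1 := by
      rw [hb]; push_cast; ring
    have e2 : |y| ^ ((-(N : ℤ) : ℤ) + θ : ℝ) = |y| * |y| ^ ((-(N : ℤ) - 1 : ℤ) + θ : ℝ) := by
      nth_rewrite 2 [← Real.rpow_one |y|]
      rw [← Real.rpow_add hy0]
      congr 1; push_cast; ring
    rw [e1, norm_Gamma_add_one (hne b y hy), e2] at h2 h3
    have h4 := hup b y hy
    have h5 : |b| / δ + 1 ≤ (N + 2) / δ + 1 := by
      gcongr
      have : (0 : ℝ) ≤ N := N.cast_nonneg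
      rw [abs_le, hb]
      push_cast
      constructor <;> linarith
    have hG := norm_nonneg (Gamma (b + y * I))
    constructor
    · refine le_of_mul_le_mul_left ?_ hy0
      calc |y| * ‖Gamma (b + y * I)‖ ≤ ‖(b + y * I : ℂ)‖ * ‖Gamma (b + y * I)‖ := by
            gcongr; exact hlow b y
        _ ≤ 1 * (C * (|y| * |y| ^ ((-(N : ℤ) - 1 : ℤ) + θ : ℝ)) * ‖Gamma (1 + y * I)‖) := by
            rw [one_mul]; exact h2
        _ ≤ ((N + 2) / δ + 1) *
              (C * (|y| * |y| ^ ((-(N : ℤ) - 1 : ℤ) + θ : ℝ)) * ‖Gamma (1 + y * I)‖) := by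
            gcongr
        _ = _ := by ring
    · refine le_of_mul_le_mul_left ?_ hy0
      calc _ = |y| * |y| ^ ((-(N : ℤ) - 1 : ℤ) + θ : ℝ) * ‖Gamma (1 + y * I)‖ := by ring
        _ ≤ C * (‖(b + y * I : ℂ)‖ * ‖Gamma (b + y * I)‖) := h3
        _ ≤ C * (((N + 2) / δ + 1) * |y| * ‖Gamma (b + y * I)‖) := by
            gcongr
            exact h4.trans (by gcongr)
        _ = _ := by ring

/-- The vertical growth of the Gamma function, uniform for abscissas in a bounded set: for
`|y| ≥ δ` the quotient `‖Γ (a + iy)‖ / ‖Γ (1 + iy)‖` is comparable with `|y| ^ (a - 1)`. -/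
theorem norm_Gamma_comparable {δ : ℝ} (hδ : 0 < δ) (A : ℝ) :
    ∃ C : ℝ, 1 ≤ C ∧ ∀ a y : ℝ, |a| ≤ A → δ ≤ |y| →
      ‖Gamma (a + y * I)‖ ≤ C * |y| ^ (a - 1) * ‖Gamma (1 + y * I)‖ ∧
      |y| ^ (a - 1) * ‖Gamma (1 + y * I)‖ ≤ C * ‖Gamma (a + y * I)‖ := by
  choose C hC1 hC using norm_Gamma_comparable_unit hδ
  set S : Finset ℤ := Finset.Icc (-⌈A⌉ - 2) ⌈A⌉ with hS
  have hCS : ∀ N ∈ S, C N ≤ 1 + ∑ N ∈ S, C N := fun N hN => by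
    have := Finset.single_le_sum (f := C) (fun i _ => zero_le_one.trans (hC1 i)) hN
    linarith
  refine ⟨1 + ∑ N ∈ S, C N, ?_, fun a y ha hy => ?_⟩
  · have := Finset.sum_nonneg (s := S) (f := C) fun i _ => zero_le_one.trans (hC1 i)
    linarith
  · have hmem : ⌊a - 1⌋ ∈ S := by
      rw [abs_le] at ha
      rw [hS, Finset.mem_Icc]
      have hA := Int.le_ceil A
      constructor
      · rw [Int.le_floor]; push_cast; linarith
      · have : ((⌊a - 1⌋ : ℤ) : ℝ) ≤ (⌈A⌉ : ℝ) := (Int.floor_le _).trans (by linarith)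
        exact_mod_cast this
    obtain ⟨h1, h2⟩ := hC ⌊a - 1⌋ (Int.fract (a - 1)) y (Int.fract_nonneg _)
      (Int.fract_lt_one _).le hy
    rw [add_assoc, Int.floor_add_fract, add_sub_cancel] at h1 h2
    refine ⟨h1.trans ?_, h2.trans ?_⟩
    · gcongr
      exact hCS _ hmem
    · gcongr
      exact hCS _ hmem

/-! ### Estimates for the Gamma factors -/

/-- Conjugation turns the denominator of the Gamma factor into a value with the imaginary part of
the numerator. -/
theorem norm_gammaFactor (m : ℤ) (u y : ℝ) :
    ‖gammaFactor m (u + y * I)‖ = (2 * Real.pi) ^ (1 - 2 * u)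
      * (‖Gamma ((u + |(m : ℝ)| / 2 : ℝ) + y * I)‖
        / ‖Gamma ((1 - u + |(m : ℝ)| / 2 : ℝ) + y * I)‖) := by
  have h0 : ((|m| : ℤ) : ℂ) = ((|(m : ℝ)| : ℝ) : ℂ) := by
    rw [← Int.cast_abs, ofReal_intCast]
  have h1 : (1 - (u + y * I) + ((|m| : ℤ) : ℂ) / 2 : ℂ)
      = (starRingEnd ℂ) ((1 - u + |(m : ℝ)| / 2 : ℝ) + y * I) := by
    simp only [map_add, map_mul, conj_ofReal, conj_I, h0]
    push_cast
    ring
  have h2 : (u + y * I + ((|m| : ℤ) : ℂ) / 2 : ℂ) = (u + |(m : ℝ)| / 2 : ℝ) + y * I := by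
    rw [h0]
    push_cast
    ring
  rw [gammaFactor, h1, h2, Complex.Gamma_conj, norm_mul, norm_mul, norm_div, norm_pow,
    norm_I, one_pow, one_mul, Complex.norm_conj,
    Complex.norm_cpow_eq_rpow_re_of_pos (by positivity)]
  simp

theorem norm_gammaFactor_le {δ : ℝ} (hδ : 0 < δ) (A : ℝ) (m : ℤ) :
    ∃ C : ℝ, 1 ≤ C ∧ ∀ u y : ℝ, |u| ≤ A → δ ≤ |y| →
      ‖gammaFactor m (u + y * I)‖ ≤ C * |y| ^ (2 * u - 1) := by
  obtain ⟨C, hC1, hC⟩ := norm_Gamma_comparable hδ (1 + A + |(m : ℝ)| / 2)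
  have hpi : (1 : ℝ) ≤ 2 * Real.pi := by linarith [Real.pi_gt_three]
  have hC0 : 0 < C := by linarith
  refine ⟨(2 * Real.pi) ^ (1 + 2 * |A|) * (C * C), ?_, fun u y hu hy => ?_⟩
  · exact one_le_mul_of_one_le_of_one_le (Real.one_le_rpow hpi (by positivity))
      (one_le_mul_of_one_le_of_one_le hC1 hC1)
  have hy0 : 0 < |y| := hδ.trans_le hy
  have hm : 0 ≤ |(m : ℝ)| := abs_nonneg _
  have hu' := abs_le.1 hu
  obtain ⟨h1, -⟩ := hC (u + |(m : ℝ)| / 2) y (by rw [abs_le]; constructor <;> linarith) hy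
  obtain ⟨-, h2⟩ := hC (1 - u + |(m : ℝ)| / 2) y (by rw [abs_le]; constructor <;> linarith) hy
  have hB : 0 < ‖Gamma (1 + y * I)‖ :=
    norm_pos_iff.2 (Complex.Gamma_ne_zero_of_re_pos (by simp))
  have hG : 0 < ‖Gamma ((1 - u + |(m : ℝ)| / 2 : ℝ) + y * I)‖ := by
    have : 0 < C * ‖Gamma ((1 - u + |(m : ℝ)| / 2 : ℝ) + y * I)‖ :=
      lt_of_lt_of_le (by positivity) h2
    exact pos_of_mul_pos_right this hC0.le
  rw [norm_gammaFactor, mul_assoc]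
  have h3 : (2 * Real.pi) ^ (1 - 2 * u) ≤ (2 * Real.pi) ^ (1 + 2 * |A|) :=
    Real.rpow_le_rpow_of_exponent_le hpi (by linarith [le_abs_self A])
  refine mul_le_mul h3 ?_ (by positivity) (by positivity)
  rw [div_le_iff₀ hG]
  have e : |y| ^ (u + |(m : ℝ)| / 2 - 1)
      = |y| ^ (2 * u - 1) * |y| ^ (1 - u + |(m : ℝ)| / 2 - 1) := by
    rw [← Real.rpow_add hy0]; congr 1; ring
  calc _ ≤ C * |y| ^ (u + |(m : ℝ)| / 2 - 1) * ‖Gamma (1 + y * I)‖ := h1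
    _ = C * |y| ^ (2 * u - 1) * (|y| ^ (1 - u + |(m : ℝ)| / 2 - 1) * ‖Gamma (1 + y * I)‖) := by
        rw [e]; ring
    _ ≤ C * |y| ^ (2 * u - 1) * (C * ‖Gamma ((1 - u + |(m : ℝ)| / 2 : ℝ) + y * I)‖) := by
        gcongr
    _ = _ := by ring

/-- If `q` is a bounded multiple of `r` from both sides, then `q ^ e` is at most a constant times
`r ^ e`, uniformly for bounded exponents. -/
theorem rpow_le_of_comparable {c q r e E : ℝ} (hc : 0 < c) (hc1 : c ≤ 1) (hr : 0 < r)
    (h1 : c * r ≤ q) (h2 : q ≤ c⁻¹ * r) (he : |e| ≤ E) : q ^ e ≤ (c⁻¹) ^ E * r ^ e := by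
  have hci : 1 ≤ c⁻¹ := (one_le_inv₀ hc).2 hc1
  have hq : 0 < q := lt_of_lt_of_le (by positivity) h1
  rcases le_total 0 e with h0 | h0
  · calc q ^ e ≤ (c⁻¹ * r) ^ e := Real.rpow_le_rpow hq.le h2 h0
      _ = (c⁻¹) ^ e * r ^ e := Real.mul_rpow (by positivity) hr.le
      _ ≤ _ := by
        gcongr
        exact (le_abs_self e).trans he
  · calc q ^ e ≤ (c * r) ^ e := Real.rpow_le_rpow_of_nonpos (by positivity) h1 h0
      _ = c ^ e * r ^ e := Real.mul_rpow hc.le hr.le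
      _ = (c⁻¹) ^ (-e) * r ^ e := by rw [Real.inv_rpow hc.le, Real.rpow_neg hc.le, inv_inv]
      _ ≤ _ := by
        gcongr
        exact (neg_le_abs e).trans he

/-- The decay of `G_(ν, m)` on vertical lines, uniform for `ν` and the abscissa in bounded sets. -/
theorem norm_gammaProd_le {n : ℕ} (m : Fin n → ℤ) {A M T : ℝ} (hM : 0 ≤ M) (hMT : M < T) :
    ∃ C : ℝ, 0 < C ∧ ∀ ν ∈ hyperplane n, (∀ l, |(ν l).re| ≤ A) → (∀ l, |(ν l).im| ≤ M) →
      ∀ u t : ℝ, |u| ≤ A → T ≤ |t| →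
        ‖gammaProd ν m (u + t * I)‖ ≤ C * |t| ^ (n * (2 * u - 1)) := by
  have hT : 0 < T := hM.trans_lt hMT
  set c : ℝ := min ((T - M) / T) 2⁻¹ with hc
  have hc0 : 0 < c := lt_min (div_pos (by linarith) hT) (by norm_num)
  have hc1 : c ≤ 1 := (min_le_right _ _).trans (by norm_num)
  choose C hC1 hC using fun l => norm_gammaFactor_le (δ := T - M) (by linarith) (A + A) (m l)
  refine ⟨∏ l, (C l * (c⁻¹) ^ (4 * A + 1)), Finset.prod_pos fun l _ => ?_, ?_⟩
  · have := hC1 l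
    positivity
  intro ν hν hre him u t hu ht
  have ht0 : 0 < |t| := hT.trans_le ht
  have hfac : ∀ l, ‖gammaFactor (m l) (u + t * I - ν l)‖
      ≤ C l * (c⁻¹) ^ (4 * A + 1) * |t| ^ (2 * (u - (ν l).re) - 1) := by
    intro l
    have e : (u + t * I - ν l : ℂ) = ((u - (ν l).re : ℝ) : ℂ) + ((t - (ν l).im : ℝ) : ℂ) * I := by
      apply Complex.ext <;> simp
    have hul : |u - (ν l).re| ≤ A + A := (abs_sub _ _).trans (add_le_add hu (hre l))
    have h1 : |t| - M ≤ |t - (ν l).im| := by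
      have := abs_sub_abs_le_abs_sub t (ν l).im
      linarith [him l]
    have h2 : |t - (ν l).im| ≤ |t| + M := (abs_sub _ _).trans (by linarith [him l])
    rw [e]
    refine (hC l _ _ hul (by linarith)).trans ?_
    rw [mul_assoc]
    refine mul_le_mul_of_nonneg_left ?_ (by linarith [hC1 l])
    refine rpow_le_of_comparable hc0 hc1 ht0 ?_ ?_ ?_
    · refine le_trans ?_ h1
      have : c * |t| ≤ (T - M) / T * |t| := by gcongr; exact min_le_left _ _
      refine this.trans ?_
      rw [div_mul_eq_mul_div, div_le_iff₀ hT]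
      nlinarith
    · refine h2.trans ?_
      have h3 : c ≤ 2⁻¹ := min_le_right _ _
      have h4 : 2 ≤ c⁻¹ := by rw [le_inv_comm₀ (by norm_num) hc0]; exact h3
      nlinarith
    · have := abs_le.1 hul
      rw [abs_le]
      constructor <;> linarith
  rw [gammaProd, norm_prod]
  refine (Finset.prod_le_prod (fun l _ => norm_nonneg _) fun l _ => hfac l).trans (le_of_eq ?_)
  rw [Finset.prod_mul_distrib, ← Real.rpow_sum_of_pos ht0]
  congr 2
  -- the exponents `2 (u - Re ν_l) - 1` add up to `n (2 u - 1)` on the hyperplane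
  have hsum : ∑ l, (ν l).re = 0 := by
    rw [← Complex.re_sum, show ∑ l, ν l = 0 from hν, zero_re]
  rw [Finset.sum_sub_distrib, ← Finset.mul_sum, Finset.sum_sub_distrib, hsum]
  simp
  ring

/-! ### Regularity of the integrand -/

/-- The point `s` is none of the poles `ν_l - |m_l| / 2 - j`, `j ∈ ℕ`, of `G_(ν, m)`. -/
def Regular {n : ℕ} (ν : Fin n → ℂ) (m : Fin n → ℤ) (s : ℂ) : Prop :=
  ∀ l, ∀ j : ℕ, s - ν l + ((|m l| : ℤ) : ℂ) / 2 ≠ -j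

theorem abs_div_two_eq_ofReal (m : ℤ) : ((|m| : ℤ) : ℂ) / 2 = ((|(m : ℝ)| / 2 : ℝ) : ℂ) := by
  rw [← Int.cast_abs, ofReal_div, ofReal_intCast, ofReal_ofNat]

theorem regular_of_im {n : ℕ} {ν : Fin n → ℂ} {m : Fin n → ℤ} {s : ℂ}
    (h : ∀ l, |(ν l).im| < |s.im|) : Regular ν m s := by
  intro l j hj
  have h1 := congrArg Complex.im hj
  have h2 : (((|m l| : ℤ) : ℂ) / 2).im = 0 := by
    rw [abs_div_two_eq_ofReal, ofReal_im]
  rw [add_im, sub_im, h2] at h1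
  simp only [add_zero, neg_im, natCast_im, neg_zero] at h1
  have h3 := h l
  rw [sub_eq_zero.1 h1] at h3
  exact lt_irrefl _ h3

theorem re_abs_div_two (m : ℤ) : (((|m| : ℤ) : ℂ) / 2).re = |(m : ℝ)| / 2 := by
  rw [abs_div_two_eq_ofReal, ofReal_re]

theorem regular_of_re {n : ℕ} {ν : Fin n → ℂ} {m : Fin n → ℤ} {s : ℂ}
    (h : ∀ l, (ν l).re - ((|m l| : ℤ) : ℝ) / 2 < s.re) : Regular ν m s := by
  intro l j hj
  have h1 := congrArg Complex.re hj
  rw [add_re, sub_re, re_abs_div_two] at h1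
  simp only [neg_re, natCast_re] at h1
  have h3 := h l
  rw [Int.cast_abs] at h3
  have : (0 : ℝ) ≤ j := j.cast_nonneg
  linarith

theorem ofReal_two_pi_ne_zero : ((2 * Real.pi : ℝ) : ℂ) ≠ 0 := by
  have := Real.pi_pos
  exact_mod_cast (by positivity : (2 * Real.pi : ℝ) ≠ 0)

theorem differentiableAt_gammaFactor {m : ℤ} {s : ℂ}
    (h : ∀ j : ℕ, s + ((|m| : ℤ) : ℂ) / 2 ≠ -j) : DifferentiableAt ℂ (gammaFactor m) s := by
  have e : gammaFactor m = fun s => I ^ m.natAbs * ((2 * Real.pi : ℝ) : ℂ) ^ (1 - 2 * s)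
      * (Gamma (s + ((|m| : ℤ) : ℂ) / 2) * (Gamma (1 - s + ((|m| : ℤ) : ℂ) / 2))⁻¹) := by
    funext s; rw [gammaFactor, div_eq_mul_inv]
  rw [e]
  refine DifferentiableAt.mul (DifferentiableAt.const_mul
    (DifferentiableAt.const_cpow (by fun_prop) (.inl ofReal_two_pi_ne_zero)) _) (DifferentiableAt.mul ?_ ?_)
  · exact (Complex.differentiableAt_Gamma _ h).comp s (by fun_prop)
  · exact (Complex.differentiable_one_div_Gamma _).comp s
      (f := fun s : ℂ => 1 - s + ((|m| : ℤ) : ℂ) / 2) (by fun_prop)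

theorem differentiableAt_integrand {n : ℕ} {ν : Fin n → ℂ} {m : Fin n → ℤ} {x : ℝ} (hx : 0 < x)
    {s : ℂ} (h : Regular ν m s) : DifferentiableAt ℂ (integrand ν m x) s := by
  have hx' : (x : ℂ) ≠ 0 := by exact_mod_cast hx.ne'
  refine DifferentiableAt.mul (DifferentiableAt.fun_finsetProd fun l _ => ?_)
    (DifferentiableAt.const_cpow (by fun_prop) (.inl hx'))
  exact (differentiableAt_gammaFactor (h l)).comp s (f := fun s => s - ν l) (by fun_prop)

/-- Joint continuity in the index and the integration variable. -/
theorem continuousAt_integrand {n : ℕ} {ν : Fin n → ℂ} {m : Fin n → ℤ} {x : ℝ} (hx : 0 < x)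
    {s : ℂ} (h : Regular ν m s) :
    ContinuousAt (fun p : (Fin n → ℂ) × ℂ => integrand p.1 m x p.2) (ν, s) := by
  have hx' : (x : ℂ) ≠ 0 := by exact_mod_cast hx.ne'
  refine ContinuousAt.mul ?_ (ContinuousAt.const_cpow (by fun_prop) (.inl hx'))
  refine tendsto_finsetProd _ fun l _ => ?_
  exact ContinuousAt.comp (g := gammaFactor (m l)) (f := fun p : (Fin n → ℂ) × ℂ => p.2 - p.1 l)
    (x := (ν, s)) (differentiableAt_gammaFactor (h l)).continuousAt (by fun_prop)

theorem norm_cpow_neg_two_mul {x : ℝ} (hx : 0 < x) (s : ℂ) :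
    ‖(x : ℂ) ^ (-2 * s)‖ = x ^ (-2 * s.re) := by
  rw [Complex.norm_cpow_eq_rpow_re_of_pos hx]
  simp

/-- The decay of the integrand on vertical lines to the left of `σ`, uniform for `ν` and the
abscissa in bounded sets. -/
theorem norm_integrand_le {n : ℕ} (m : Fin n → ℤ) {x : ℝ} (hx : 0 < x) {A M T σ : ℝ} (hM : 0 ≤ M)
    (hMT : M < T) :
    ∃ C : ℝ, 0 < C ∧ ∀ ν ∈ hyperplane n, (∀ l, |(ν l).re| ≤ A) → (∀ l, |(ν l).im| ≤ M) →
      ∀ u t : ℝ, |u| ≤ A → u ≤ σ → T ≤ |t| →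
        ‖integrand ν m x (u + t * I)‖ ≤ C * |t| ^ (n * (2 * σ - 1)) := by
  obtain ⟨C, hC0, hC⟩ := norm_gammaProd_le m (A := A) hM hMT
  have hT : 0 < T := hM.trans_lt hMT
  have hcont : ContinuousOn (fun u : ℝ => x ^ (-2 * u) * T ^ (n * (2 * u - 1) - n * (2 * σ - 1)))
      (Icc (-A) A) := by
    refine Continuous.continuousOn (Continuous.mul ?_ ?_)
    · exact Continuous.rpow continuous_const (by fun_prop) fun _ => .inl hx.ne'
    · exact Continuous.rpow continuous_const (by fun_prop) fun _ => .inl hT.ne'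
  obtain ⟨D, hD⟩ := isCompact_Icc.exists_bound_of_continuousOn hcont
  refine ⟨C * (|D| + 1), by positivity, fun ν hν hre him u t hu huσ ht => ?_⟩
  have ht0 : 0 < |t| := hT.trans_le ht
  have h1 := hC ν hν hre him u t hu ht
  have h2 := hD u (by rw [abs_le] at hu; exact hu)
  rw [Real.norm_of_nonneg (by positivity)] at h2
  have h3 : |t| ^ (n * (2 * u - 1))
      ≤ |t| ^ (n * (2 * σ - 1)) * T ^ (n * (2 * u - 1) - n * (2 * σ - 1)) := by
    have e : |t| ^ (n * (2 * u - 1))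
        = |t| ^ (n * (2 * σ - 1)) * |t| ^ (n * (2 * u - 1) - n * (2 * σ - 1)) := by
      rw [← Real.rpow_add ht0]; congr 1; ring
    rw [e]
    refine mul_le_mul_of_nonneg_left (Real.rpow_le_rpow_of_nonpos hT ht ?_) (by positivity)
    have : (0 : ℝ) ≤ n := n.cast_nonneg
    nlinarith
  rw [integrand, norm_mul, norm_cpow_neg_two_mul hx]
  have h4 : (u + t * I : ℂ).re = u := by simp
  rw [h4]
  calc _ ≤ C * |t| ^ (n * (2 * u - 1)) * x ^ (-2 * u) := by gcongr
    _ ≤ C * (|t| ^ (n * (2 * σ - 1)) * T ^ (n * (2 * u - 1) - n * (2 * σ - 1)))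
          * x ^ (-2 * u) := by gcongr
    _ = C * |t| ^ (n * (2 * σ - 1))
          * (x ^ (-2 * u) * T ^ (n * (2 * u - 1) - n * (2 * σ - 1))) := by ring
    _ ≤ C * |t| ^ (n * (2 * σ - 1)) * (|D| + 1) := by
        gcongr
        linarith [le_abs_self D]
    _ = _ := by ring

/-! ### Admissible contours -/

/-- The conditions on the contour with parameters `σ`, `ρ`, `T` for the index `(ν, m)`, where `ν`
lies in the hyperplane. The field `decay` is the condition on `σ`: the integrand is
`O(|t| ^ (n (2σ - 1)))` on the half lines. Unlike `Contour`, this is a proposition, so that one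
contour can serve for all `ν` near a given index. -/
structure Admissible {n : ℕ} (ν : Fin n → ℂ) (m : Fin n → ℤ) (σ ρ T : ℝ) : Prop where
  decay : (n : ℝ) * (2 * σ - 1) < -1
  lt_ρ : ∀ l, (ν l).re - ((|m l| : ℤ) : ℝ) / 2 < ρ
  lt_T : ∀ l, |(ν l).im| < T

theorem Contour.admissible {n : ℕ} (hn : 1 ≤ n) {ν : Fin n → ℂ} (hν : ν ∈ hyperplane n)
    {m : Fin n → ℤ} (C : Contour ν m) : Admissible ν m C.σ C.ρ C.T := by
  refine ⟨?_, C.lt_ρ, C.lt_T⟩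
  have h := C.σ_lt
  rw [show ∑ l, ν l = 0 from hν, zero_re] at h
  have hn' : (0 : ℝ) < n := by exact_mod_cast hn
  have h2 := mul_lt_mul_of_pos_left h hn'
  have h3 : (n : ℝ) * (1 / 2 + 1 / (n : ℝ) * (0 - 1 / 2)) = n / 2 - 1 / 2 := by
    field_simp
    ring
  rw [h3] at h2
  linarith

theorem exists_re_bound {n : ℕ} (ν : Fin n → ℂ) : ∃ A, ∀ l, |(ν l).re| < A := by
  obtain ⟨B, hB⟩ := (Set.finite_range fun l => |(ν l).re|).bddAbove
  exact ⟨B + 1, fun l => (hB ⟨l, rfl⟩).trans_lt (lt_add_one B)⟩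

namespace Admissible

variable {n : ℕ} {ν : Fin n → ℂ} {m : Fin n → ℤ} {σ ρ T x : ℝ}

theorem T_pos (h : Admissible ν m σ ρ T) (hn : 1 ≤ n) : 0 < T :=
  (abs_nonneg _).trans_lt (h.lt_T ⟨0, hn⟩)

theorem regular_im (h : Admissible ν m σ ρ T) {s : ℂ} (hs : T ≤ |s.im|) : Regular ν m s :=
  regular_of_im fun l => (h.lt_T l).trans_le hs

theorem regular_re (h : Admissible ν m σ ρ T) {s : ℂ} (hs : ρ ≤ s.re) : Regular ν m s :=
  regular_of_re fun l => (h.lt_ρ l).trans_le hs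

theorem exists_im_bound (h : Admissible ν m σ ρ T) (hn : 1 ≤ n) :
    ∃ M, 0 ≤ M ∧ M < T ∧ ∀ l, |(ν l).im| < M := by
  have h1 : ∀ᶠ M in 𝓝[<] T, ∀ l, |(ν l).im| < M :=
    eventually_all.2 fun l => nhdsWithin_le_nhds (eventually_gt_nhds (h.lt_T l))
  have h2 : ∀ᶠ M in 𝓝[<] T, 0 < M := nhdsWithin_le_nhds (eventually_gt_nhds (h.T_pos hn))
  obtain ⟨M, hM, hM0, hMT⟩ := (h1.and (h2.and self_mem_nhdsWithin)).exists
  exact ⟨M, hM0.le, hMT, hM⟩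

theorem eventually (h : Admissible ν m σ ρ T) : ∀ᶠ κ in 𝓝 ν, Admissible κ m σ ρ T := by
  have h1 : ∀ᶠ κ : Fin n → ℂ in 𝓝 ν, ∀ l, (κ l).re - ((|m l| : ℤ) : ℝ) / 2 < ρ := by
    refine eventually_all.2 fun l => ?_
    have : Continuous fun κ : Fin n → ℂ => (κ l).re - ((|m l| : ℤ) : ℝ) / 2 := by fun_prop
    exact this.continuousAt.eventually_lt continuousAt_const (h.lt_ρ l)
  have h2 : ∀ᶠ κ : Fin n → ℂ in 𝓝 ν, ∀ l, |(κ l).im| < T := by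
    refine eventually_all.2 fun l => ?_
    have : Continuous fun κ : Fin n → ℂ => |(κ l).im| := by fun_prop
    exact this.continuousAt.eventually_lt continuousAt_const (h.lt_T l)
  filter_upwards [h1, h2] with κ h3 h4
  exact ⟨h.decay, h3, h4⟩

theorem integrableOn_Ioi (h : Admissible ν m σ ρ T) (hn : 1 ≤ n) (hν : ν ∈ hyperplane n)
    (hx : 0 < x) : IntegrableOn (fun t : ℝ => integrand ν m x (σ + t * I)) (Ioi T) := by
  obtain ⟨M, hM0, hMT, hM⟩ := h.exists_im_bound hn
  obtain ⟨A, hA⟩ := exists_re_bound ν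
  obtain ⟨C, -, hC⟩ := norm_integrand_le m hx (A := max A |σ|) (σ := σ) hM0 hMT
  exact integrableOn_vertical (h.T_pos hn) h.decay
    (fun s hs => differentiableAt_integrand hx (h.regular_im hs)) fun t ht =>
      hC ν hν (fun l => (hA l).le.trans (le_max_left _ _)) (fun l => (hM l).le) σ t
        (le_max_right _ _) le_rfl ht

theorem integrableOn_Iic (h : Admissible ν m σ ρ T) (hn : 1 ≤ n) (hν : ν ∈ hyperplane n)
    (hx : 0 < x) : IntegrableOn (fun t : ℝ => integrand ν m x (σ + t * I)) (Iic (-T)) := by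
  obtain ⟨M, hM0, hMT, hM⟩ := h.exists_im_bound hn
  obtain ⟨A, hA⟩ := exists_re_bound ν
  obtain ⟨C, -, hC⟩ := norm_integrand_le m hx (A := max A |σ|) (σ := σ) hM0 hMT
  have key : ∀ t : ℝ, -(((-σ : ℝ) : ℂ) + (t : ℂ) * I) = σ + ((-t : ℝ) : ℂ) * I := by
    intro t
    push_cast
    ring
  have h1 := integrableOn_vertical (u := -σ) (F := fun s => integrand ν m x (-s)) (C := C)
    (h.T_pos hn) h.decay
    (fun s hs => (differentiableAt_integrand hx (h.regular_im (s := -s) (by simpa using hs))).comp s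
      differentiable_neg.differentiableAt) fun t ht => by
      rw [key]
      have := hC ν hν (fun l => (hA l).le.trans (le_max_left _ _)) (fun l => (hM l).le) σ (-t)
        (le_max_right _ _) le_rfl (by rwa [abs_neg])
      rwa [abs_neg] at this
  simp only [key] at h1
  rw [integrableOn_Iic_iff_integrableOn_Iio]
  have h2 := (Measure.measurePreserving_neg (volume : Measure ℝ)).integrableOn_comp_preimage
    (Homeomorph.neg ℝ).measurableEmbedding
    (f := fun t : ℝ => integrand ν m x (σ + t * I)) (s := Iio (-T))
  refine h2.1 ?_
  simpa [Function.comp_def] using h1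

theorem contourConverges (h : Admissible ν m σ ρ T) (hn : 1 ≤ n) (hν : ν ∈ hyperplane n)
    (hx : 0 < x) : ContourConverges σ T (integrand ν m x) :=
  ⟨h.integrableOn_Iic hn hν hx, h.integrableOn_Ioi hn hν hx⟩

end Admissible

/-! ### Continuity in the index -/

theorem tendsto_integral_segment {n : ℕ} {μ : Fin n → ℂ} {m : Fin n → ℤ} {x : ℝ} (hx : 0 < x)
    {γ : ℝ → ℂ} (hγ : Continuous γ) {a b : ℝ}
    (hreg : ∀ᶠ ν in 𝓝 μ, ∀ t ∈ uIcc a b, Regular ν m (γ t)) :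
    Tendsto (fun ν => ∫ t in a..b, integrand ν m x (γ t)) (𝓝 μ)
      (𝓝 (∫ t in a..b, integrand μ m x (γ t))) := by
  have hcont : ∀ ν, (∀ t ∈ uIcc a b, Regular ν m (γ t)) →
      ContinuousOn (fun t => integrand ν m x (γ t)) (uIcc a b) := fun ν hν t ht =>
    (ContinuousAt.comp (f := γ) (differentiableAt_integrand hx (hν t ht)).continuousAt
      hγ.continuousAt).continuousWithinAt
  have hjoint : ∀ t ∈ uIcc a b, ContinuousAt
      (fun p : (Fin n → ℂ) × ℝ => integrand p.1 m x (γ p.2)) (μ, t) := fun t ht =>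
    ContinuousAt.comp (f := fun p : (Fin n → ℂ) × ℝ => (p.1, γ p.2)) (x := (μ, t))
      (continuousAt_integrand hx (hreg.self_of_nhds t ht)) (by fun_prop)
  have hunif : ∀ᶠ ν in 𝓝 μ, ∀ t ∈ uIcc a b,
      ‖integrand ν m x (γ t) - integrand μ m x (γ t)‖ < 1 := by
    refine isCompact_uIcc.eventually_forall_of_forall_eventually fun t ht => ?_
    have h1 : ContinuousAt (fun p : (Fin n → ℂ) × ℝ =>
        ‖integrand p.1 m x (γ p.2) - integrand μ m x (γ p.2)‖) (μ, t) := by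
      refine ((hjoint t ht).sub ?_).norm
      exact ContinuousAt.comp (g := fun s => integrand μ m x s)
        (f := fun p : (Fin n → ℂ) × ℝ => γ p.2) (x := (μ, t))
        (differentiableAt_integrand hx (hreg.self_of_nhds t ht)).continuousAt (by fun_prop)
    exact h1.eventually_lt continuousAt_const (by simp)
  obtain ⟨D, hD⟩ := isCompact_uIcc.exists_bound_of_continuousOn
    (hcont μ hreg.self_of_nhds)
  refine intervalIntegral.tendsto_integral_filter_of_dominated_convergence (fun _ => D + 1) ?_ ?_
    intervalIntegrable_const ?_
  · filter_upwards [hreg] with ν hν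
    exact ((hcont ν hν).mono uIoc_subset_uIcc).aestronglyMeasurable measurableSet_uIoc
  · filter_upwards [hunif] with ν hν
    refine .of_forall fun t ht => ?_
    have h1 := hν t (uIoc_subset_uIcc ht)
    have h2 := hD t (uIoc_subset_uIcc ht)
    calc ‖integrand ν m x (γ t)‖
        = ‖integrand μ m x (γ t) + (integrand ν m x (γ t) - integrand μ m x (γ t))‖ := by
          rw [add_sub_cancel]
      _ ≤ D + 1 := (norm_add_le _ _).trans (add_le_add h2 h1.le)
  · refine .of_forall fun t ht => ?_
    have h1 := hjoint t (uIoc_subset_uIcc ht)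
    exact Tendsto.comp (x := 𝓝 μ) (f := fun ν => ((ν, t) : (Fin n → ℂ) × ℝ)) h1
      (Continuous.tendsto (by fun_prop) μ)

theorem tendsto_integral_tail {n : ℕ} (hn : 1 ≤ n) {μ : Fin n → ℂ}
    {m : Fin n → ℤ} {σ ρ T x : ℝ} (hx : 0 < x) (h : Admissible μ m σ ρ T) {S : Set ℝ}
    (hS : MeasurableSet S) (hST : ∀ t ∈ S, T ≤ |t|)
    (hint : IntegrableOn (fun t : ℝ => |t| ^ (n * (2 * σ - 1))) S) :
    Tendsto (fun ν => ∫ t in S, integrand ν m x (σ + t * I)) (𝓝[hyperplane n] μ)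
      (𝓝 (∫ t in S, integrand μ m x (σ + t * I))) := by
  obtain ⟨M, hM0, hMT, hM⟩ := h.exists_im_bound hn
  obtain ⟨A, hA⟩ := exists_re_bound μ
  obtain ⟨C, -, hC⟩ := norm_integrand_le m hx (A := max A |σ|) (σ := σ) hM0 hMT
  have hadm : ∀ᶠ ν in 𝓝[hyperplane n] μ, Admissible ν m σ ρ T :=
    nhdsWithin_le_nhds h.eventually
  have hre : ∀ᶠ ν : Fin n → ℂ in 𝓝[hyperplane n] μ, ∀ l, |(ν l).re| < A := by
    refine nhdsWithin_le_nhds (eventually_all.2 fun l => ?_)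
    have : Continuous fun κ : Fin n → ℂ => |(κ l).re| := by fun_prop
    exact this.continuousAt.eventually_lt continuousAt_const (hA l)
  have him : ∀ᶠ ν : Fin n → ℂ in 𝓝[hyperplane n] μ, ∀ l, |(ν l).im| < M := by
    refine nhdsWithin_le_nhds (eventually_all.2 fun l => ?_)
    have : Continuous fun κ : Fin n → ℂ => |(κ l).im| := by fun_prop
    exact this.continuousAt.eventually_lt continuousAt_const (hM l)
  refine tendsto_integral_filter_of_dominated_convergence _ ?_ ?_ (hint.const_mul C) ?_
  · filter_upwards [hadm] with ν hν
    refine ContinuousOn.aestronglyMeasurable (fun t ht => ?_) hS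
    have h1 : ContinuousAt (integrand ν m x) (σ + t * I) :=
      (differentiableAt_integrand hx (hν.regular_im (by simpa using hST t ht))).continuousAt
    exact (ContinuousAt.comp (f := fun t : ℝ => (σ + t * I : ℂ)) h1
      (by fun_prop)).continuousWithinAt
  · filter_upwards [hre, him, self_mem_nhdsWithin] with ν h1 h2 hν
    filter_upwards [ae_restrict_mem hS] with t ht
    exact hC ν hν (fun l => (h1 l).le.trans (le_max_left _ _)) (fun l => (h2 l).le) σ t
      (le_max_right _ _) le_rfl (hST t ht)
  · filter_upwards [ae_restrict_mem hS] with t ht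
    have h1 := continuousAt_integrand hx
      (h.regular_im (s := σ + t * I) (by simpa using hST t ht))
    refine Tendsto.mono_left ?_ nhdsWithin_le_nhds
    exact Tendsto.comp (x := 𝓝 μ) (f := fun ν => ((ν, (σ + t * I : ℂ)) : (Fin n → ℂ) × ℂ)) h1
      (Continuous.tendsto (by fun_prop) μ)

theorem tendsto_contourIntegral {n : ℕ} (hn : 1 ≤ n) {μ : Fin n → ℂ}
    {m : Fin n → ℤ} {σ ρ T x : ℝ} (hx : 0 < x) (h : Admissible μ m σ ρ T) :
    Tendsto (fun ν => contourIntegral σ ρ T (integrand ν m x)) (𝓝[hyperplane n] μ)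
      (𝓝 (contourIntegral σ ρ T (integrand μ m x))) := by
  have hT := h.T_pos hn
  have hpos : IntegrableOn (fun t : ℝ => |t| ^ (n * (2 * σ - 1))) (Ioi T) := by
    refine (integrableOn_Ioi_rpow_of_lt h.decay hT).congr_fun (fun t ht => ?_) measurableSet_Ioi
    simp only [abs_of_pos (hT.trans ht)]
  have hneg : IntegrableOn (fun t : ℝ => |t| ^ (n * (2 * σ - 1))) (Iic (-T)) := by
    rw [integrableOn_Iic_iff_integrableOn_Iio]
    have h2 := (Measure.measurePreserving_neg (volume : Measure ℝ)).integrableOn_comp_preimage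
      (Homeomorph.neg ℝ).measurableEmbedding
      (f := fun t : ℝ => |t| ^ (n * (2 * σ - 1))) (s := Iio (-T))
    refine h2.1 ?_
    simpa [Function.comp_def] using hpos
  have t1 := tendsto_integral_tail hn hx h measurableSet_Iic
    (fun t (ht : t ≤ -T) => by rw [le_abs]; right; linarith) hneg
  have t5 := tendsto_integral_tail hn hx h measurableSet_Ioi
    (fun t (ht : T < t) => ht.le.trans (le_abs_self t)) hpos
  have t2 := (tendsto_integral_segment (m := m) hx (γ := fun u : ℝ => (u - T * I : ℂ))
    (by fun_prop) (a := σ) (b := ρ)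
    (h.eventually.mono fun ν hν t _ => hν.regular_im (by simp [le_abs_self]))).mono_left
      (nhdsWithin_le_nhds (s := hyperplane n))
  have t4 := (tendsto_integral_segment (m := m) hx (γ := fun u : ℝ => (u + T * I : ℂ))
    (by fun_prop) (a := ρ) (b := σ)
    (h.eventually.mono fun ν hν t _ => hν.regular_im (by simp [le_abs_self]))).mono_left
      (nhdsWithin_le_nhds (s := hyperplane n))
  have t3 := (tendsto_integral_segment (m := m) hx (γ := fun t : ℝ => (ρ + t * I : ℂ))
    (by fun_prop) (a := -T) (b := T)
    (h.eventually.mono fun ν hν t _ => hν.regular_re (by simp))).mono_left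
      (nhdsWithin_le_nhds (s := hyperplane n))
  simp only [contourIntegral, integral_mul_const, intervalIntegral.integral_mul_const]
  exact ((((t1.mul_const I).add t2).add (t3.mul_const I)).add t4).add (t5.mul_const I)

/-! ### Uniform decay in the Fourier variable -/

theorem norm_gammaFactor_le_of_le {m : ℤ} {u y E : ℝ} (hu : u ≤ -2) (hE : 1 - 2 * u ≤ E)
    (hX : 1 ≤ u + |(m : ℝ)| / 2) :
    ‖gammaFactor m (u + y * I)‖
      ≤ (2 * Real.pi) ^ E * 2 / ((u + |(m : ℝ)| / 2) ^ 2 + y ^ 2) ^ 2 := by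
  set X := u + |(m : ℝ)| / 2 with hXdef
  have h1 := norm_Gamma_mul_pow_four_le (x := X) (y := y) (e := 1 - 2 * u) hX (by linarith)
  rw [show X + (1 - 2 * u) = 1 - u + |(m : ℝ)| / 2 by rw [hXdef]; ring] at h1
  have hn : ‖(X + y * I : ℂ)‖ ^ 4 = (X ^ 2 + y ^ 2) ^ 2 := by
    rw [norm_ofReal_add_ofReal_mul_I, show 4 = 2 * 2 from rfl, pow_mul,
      Real.sq_sqrt (by positivity)]
  rw [hn] at h1
  have hpos : 0 < (X ^ 2 + y ^ 2) ^ 2 := by positivity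
  have hG : 0 < ‖Gamma ((1 - u + |(m : ℝ)| / 2 : ℝ) + y * I)‖ := by
    refine norm_pos_iff.2 (Complex.Gamma_ne_zero_of_re_pos ?_)
    simp only [add_re, ofReal_re, mul_re, I_re, mul_zero, ofReal_im, I_im, mul_one, sub_self,
      add_zero]
    have := abs_nonneg (m : ℝ)
    linarith
  rw [norm_gammaFactor, mul_div_assoc]
  refine mul_le_mul (Real.rpow_le_rpow_of_exponent_le (by linarith [Real.pi_gt_three]) hE) ?_
    (by positivity) (by positivity)
  rw [div_le_div_iff₀ hG hpos]
  linarith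

/-- Every factor of `G_(ν, m + κ e)` on the line of abscissa `-(R + 2)` has a numerator and a
denominator whose abscissas differ by at least `4`, and the numerator has one of size `|κ| / 4`. -/
theorem norm_gammaProd_shift_le {n : ℕ} (hn : 1 ≤ n) {m : Fin n → ℤ} {R K : ℝ}
    (hm : ∀ l, |(m l : ℝ)| ≤ K) :
    ∃ D : ℝ, 0 < D ∧ ∀ ν : Fin n → ℂ, (∀ l, |(ν l).re| ≤ R) → (∀ l, |(ν l).im| ≤ R) →
      ∀ κ : ℤ, 8 * R + 12 + 2 * K ≤ |(κ : ℝ)| → ∀ t : ℝ,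
        ‖gammaProd ν (shift m κ) ((-(R + 2) : ℝ) + t * I)‖
          ≤ D * ((1 + (κ : ℝ) ^ 2)⁻¹ * (1 + t ^ 2)⁻¹) := by
  set Q : ℝ := (2 * Real.pi) ^ (4 * R + 5) * 2 * (32 * (1 + R ^ 2)) with hQ
  have hQ0 : 0 < Q := by positivity
  refine ⟨Q ^ n, by positivity, fun ν hre him κ hκ t => ?_⟩
  have hfac : ∀ l, ‖gammaFactor (shift m κ l) ((-(R + 2) : ℝ) + t * I - ν l)‖
      ≤ Q * ((1 + (κ : ℝ) ^ 2)⁻¹ * (1 + t ^ 2)⁻¹) := by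
    intro l
    set u : ℝ := -(R + 2) - (ν l).re with hu
    set y : ℝ := t - (ν l).im with hy
    have e : (((-(R + 2) : ℝ) : ℂ) + t * I - ν l) = (u : ℂ) + (y : ℂ) * I := by
      apply Complex.ext <;> simp [hu, hy]
    have h1 := abs_le.1 (hre l)
    have h2 := abs_le.1 (him l)
    have hs : |(κ : ℝ)| - K ≤ |((shift m κ l : ℤ) : ℝ)| := by
      have := abs_sub_abs_le_abs_sub (κ : ℝ) (-(m l : ℝ))
      rw [abs_neg, sub_neg_eq_add, add_comm (κ : ℝ)] at this
      have h3 := hm l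
      simp only [shift]
      push_cast
      linarith
    have hX : |(κ : ℝ)| / 4 + 1 ≤ u + |((shift m κ l : ℤ) : ℝ)| / 2 := by linarith
    have hκ0 := abs_nonneg (κ : ℝ)
    rw [e]
    refine (norm_gammaFactor_le_of_le (E := 4 * R + 5) (by linarith) (by linarith)
      (by linarith)).trans ?_
    set X := u + |((shift m κ l : ℤ) : ℝ)| / 2
    have hX2 : 1 + (κ : ℝ) ^ 2 ≤ 16 * (X ^ 2 + y ^ 2) := by
      have : (|(κ : ℝ)| / 4 + 1) ^ 2 ≤ X ^ 2 := pow_le_pow_left₀ (by positivity) hX 2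
      nlinarith [sq_abs (κ : ℝ), sq_nonneg y]
    have hy2 : 1 + t ^ 2 ≤ 2 * (1 + R ^ 2) * (X ^ 2 + y ^ 2) := by
      have hX1 : 1 ≤ X ^ 2 := by nlinarith
      have ht : t = y + (ν l).im := by rw [hy]; ring
      have hi : (ν l).im ^ 2 ≤ R ^ 2 := by nlinarith
      have : t ^ 2 ≤ 2 * y ^ 2 + 2 * R ^ 2 := by
        rw [ht]; nlinarith [sq_nonneg (y - (ν l).im)]
      nlinarith [sq_nonneg y, sq_nonneg R, mul_nonneg (sq_nonneg R) (sq_nonneg y)]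
    have hXp : 0 < X ^ 2 + y ^ 2 := by nlinarith [sq_nonneg (κ : ℝ)]
    rw [← mul_inv, ← div_eq_mul_inv, hQ, div_le_div_iff₀ (by positivity) (by positivity)]
    have h3 := mul_le_mul hX2 hy2 (by positivity) (by positivity)
    calc _ ≤ (2 * Real.pi) ^ (4 * R + 5) * 2
          * (16 * (X ^ 2 + y ^ 2) * (2 * (1 + R ^ 2) * (X ^ 2 + y ^ 2))) := by gcongr
      _ = _ := by ring
  rw [gammaProd, norm_prod]
  refine (Finset.prod_le_prod (fun l _ => norm_nonneg _) fun l _ => hfac l).trans ?_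
  rw [Finset.prod_const, Finset.card_univ, Fintype.card_fin, mul_pow]
  refine mul_le_mul_of_nonneg_left ?_ (by positivity)
  refine pow_le_of_le_one (by positivity) ?_ (by omega)
  refine mul_le_one₀ ?_ (by positivity) ?_
  · exact inv_le_one_of_one_le₀ (by nlinarith [sq_nonneg (κ : ℝ)])
  · exact inv_le_one_of_one_le₀ (by nlinarith [sq_nonneg t])

theorem norm_line_integral_le {f : ℝ → ℂ} {D : ℝ} (hc : Continuous f)
    (hf : ∀ t, ‖f t‖ ≤ D * (1 + t ^ 2)⁻¹) : Integrable f ∧ ‖∫ t, f t‖ ≤ D * Real.pi := by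
  have hi : Integrable fun t : ℝ => D * (1 + t ^ 2)⁻¹ := integrable_inv_one_add_sq.const_mul D
  refine ⟨hi.mono' hc.aestronglyMeasurable (.of_forall hf), ?_⟩
  refine (norm_integral_le_of_norm_le hi (.of_forall hf)).trans (le_of_eq ?_)
  rw [integral_const_mul, integral_univ_inv_one_add_sq]

/-- For large `|κ|` the vertical line of abscissa `-(R + 2)` is an admissible contour, and the
integral along it is `O(1 / (1 + κ²))`, uniformly for bounded `ν`. -/
theorem exists_bound_contourIntegral_shift {n : ℕ} (hn : 1 ≤ n) (m : Fin n → ℤ) {R x : ℝ}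
    (hR : 0 ≤ R) (hx : 0 < x) :
    ∃ D K : ℝ, 0 < D ∧ ∀ ν : Fin n → ℂ, (∀ l, |(ν l).re| ≤ R) → (∀ l, |(ν l).im| ≤ R) →
      ∀ κ : ℤ, K ≤ |(κ : ℝ)| →
        (∀ l, (ν l).re - ((|shift m κ l| : ℤ) : ℝ) / 2 < -(R + 2)) ∧
        ∀ T : ℝ, ‖contourIntegral (-(R + 2)) (-(R + 2)) T (integrand ν (shift m κ) x)‖
          ≤ D * (1 + (κ : ℝ) ^ 2)⁻¹ := by
  obtain ⟨K, hK⟩ := (Set.finite_range fun l => |(m l : ℝ)|).bddAbove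
  have hm : ∀ l, |(m l : ℝ)| ≤ K := fun l => hK ⟨l, rfl⟩
  obtain ⟨D, hD0, hD⟩ := norm_gammaProd_shift_le hn hm
  refine ⟨x ^ (2 * (R + 2)) * D * Real.pi, 8 * R + 12 + 2 * K,
    by have := Real.pi_pos; positivity, fun ν hre him κ hκ => ?_⟩
  have hleft : ∀ l, (ν l).re - ((|shift m κ l| : ℤ) : ℝ) / 2 < -(R + 2) := by
    intro l
    have h1 := abs_le.1 (hre l)
    have := abs_sub_abs_le_abs_sub (κ : ℝ) (-(m l : ℝ))
    rw [abs_neg, sub_neg_eq_add, add_comm (κ : ℝ)] at this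
    have h3 := hm l
    have h4 := abs_nonneg (m l : ℝ)
    rw [Int.cast_abs]
    simp only [shift]
    push_cast
    linarith
  refine ⟨hleft, fun T => ?_⟩
  set f : ℝ → ℂ := fun t => integrand ν (shift m κ) x ((-(R + 2) : ℝ) + t * I) with hf
  have hcont : Continuous f := by
    refine continuous_iff_continuousAt.2 fun t => ?_
    have h1 : ContinuousAt (integrand ν (shift m κ) x) ((-(R + 2) : ℝ) + t * I) := by
      refine (differentiableAt_integrand hx (regular_of_re fun l => ?_)).continuousAt
      simpa using hleft l
    exact ContinuousAt.comp (f := fun t : ℝ => (((-(R + 2) : ℝ) : ℂ) + t * I)) h1 (by fun_prop)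
  have hbound : ∀ t, ‖f t‖ ≤ x ^ (2 * (R + 2)) * D * (1 + (κ : ℝ) ^ 2)⁻¹ * (1 + t ^ 2)⁻¹ := by
    intro t
    have h1 := hD ν hre him κ hκ t
    have h2 : ‖f t‖ = ‖gammaProd ν (shift m κ) ((-(R + 2) : ℝ) + t * I)‖
        * x ^ (2 * (R + 2)) := by
      rw [hf]
      simp only [integrand]
      rw [norm_mul, norm_cpow_neg_two_mul hx]
      congr 2
      simp only [add_re, ofReal_re, mul_re, I_re, mul_zero, ofReal_im, I_im, mul_one, sub_self,
        add_zero]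
      ring
    rw [h2]
    calc _ ≤ D * ((1 + (κ : ℝ) ^ 2)⁻¹ * (1 + t ^ 2)⁻¹) * x ^ (2 * (R + 2)) := by gcongr
      _ = _ := by ring
  obtain ⟨hint, hnorm⟩ := norm_line_integral_le hcont hbound
  rw [contourIntegral_eq_line_add_rect hint]
  have hrect : rectIntegral (-(R + 2)) (-(R + 2)) (-T) T (integrand ν (shift m κ) x) = 0 := by
    simp [rectIntegral]
  rw [hrect, add_zero, norm_mul, norm_I, one_mul]
  refine hnorm.trans (le_of_eq ?_)
  ring

theorem summable_inv_one_add_int_sq : Summable fun κ : ℤ => (1 + (κ : ℝ) ^ 2)⁻¹ := by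
  have h : Summable fun κ : ℤ => 1 / (κ : ℝ) ^ 2 := Real.summable_one_div_int_pow.2 one_lt_two
  refine (h.add (summable_of_hasFiniteSupport (f := fun κ : ℤ => if κ = 0 then (1 : ℝ) else 0)
    ((Set.finite_singleton 0).subset fun κ hκ => by
      by_contra h0
      exact hκ (if_neg h0)))).of_nonneg_of_le (fun κ => by positivity) fun κ => ?_
  by_cases h0 : κ = 0
  · simp [h0]
  · have : (0 : ℝ) < (κ : ℝ) ^ 2 := by positivity
    simp only [h0, if_false, add_zero, one_div]
    exact inv_anti₀ this (by linarith)

/-! ### The symmetric form of the Gamma factors -/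

/-- The entire function `i^m π (2π)^(1-2s) / (Γ(1 - s - m/2) Γ(1 - s + m/2))`. By the reflection
formula, `gammaFactor m s` is its quotient by `sin (π (s + m/2))`. -/
def gammaNum (m : ℤ) (s : ℂ) : ℂ :=
  I ^ m * Real.pi * ((2 * Real.pi : ℝ) : ℂ) ^ (1 - 2 * s)
    * (Gamma (1 - s - m / 2))⁻¹ * (Gamma (1 - s + m / 2))⁻¹

theorem continuous_gammaNum (m : ℤ) : Continuous (gammaNum m) := by
  have h := Complex.differentiable_one_div_Gamma.continuous
  refine ((continuous_const.mul (Continuous.const_cpow (by fun_prop)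
    (.inl ofReal_two_pi_ne_zero))).mul ?_).mul ?_
  · exact h.comp (by fun_prop : Continuous fun s : ℂ => 1 - s - (m : ℂ) / 2)
  · exact h.comp (by fun_prop : Continuous fun s : ℂ => 1 - s + (m : ℂ) / 2)

theorem Gamma_eq_of_sin_ne_zero {s : ℂ} (h : sin (Real.pi * s) ≠ 0) :
    Gamma s = Real.pi / sin (Real.pi * s) * (Gamma (1 - s))⁻¹ := by
  have h1 := Complex.Gamma_mul_Gamma_one_sub s
  have h2 : Gamma (1 - s) ≠ 0 := by
    intro h0
    rw [h0, mul_zero] at h1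
    have hpi : (Real.pi : ℂ) ≠ 0 := by exact_mod_cast Real.pi_ne_zero
    exact div_ne_zero hpi h h1.symm
  rw [← h1, mul_inv_cancel_right₀ h2]

theorem gammaFactor_eq {m : ℤ} {s : ℂ} (h : sin (Real.pi * (s + m / 2)) ≠ 0) :
    gammaFactor m s = gammaNum m s * (sin (Real.pi * (s + m / 2)))⁻¹ := by
  rcases Int.eq_nat_or_neg m with ⟨k, rfl | rfl⟩
  · have habs : ((|(k : ℤ)| : ℤ) : ℂ) = k := by simp
    rw [Int.cast_natCast] at h
    rw [gammaFactor, gammaNum, habs, Int.natAbs_natCast, zpow_natCast, Int.cast_natCast,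
      Gamma_eq_of_sin_ne_zero h, show (1 : ℂ) - (s + k / 2) = 1 - s - k / 2 by ring]
    simp only [div_eq_mul_inv]
    ring
  · have habs : ((|(-(k : ℤ))| : ℤ) : ℂ) = k := by simp
    have hcast : ((-(k : ℤ) : ℤ) : ℂ) = -(k : ℂ) := by simp
    rw [hcast] at h
    have hsin : sin (Real.pi * (s + k / 2)) = (-1) ^ k * sin (Real.pi * (s + -(k : ℂ) / 2)) := by
      rw [show (Real.pi : ℂ) * (s + k / 2)
        = Real.pi * (s + -(k : ℂ) / 2) + (k : ℕ) * Real.pi by ring,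
        Complex.sin_antiperiodic.add_nat_mul_eq]
    have h' : sin (Real.pi * (s + k / 2)) ≠ 0 := by
      rw [hsin]
      exact mul_ne_zero (pow_ne_zero _ (by norm_num)) h
    have hI : I ^ (-(k : ℤ)) = (-1) ^ k * I ^ k := by
      rw [zpow_neg, zpow_natCast, ← mul_pow, ← inv_pow, inv_I, neg_one_mul]
    have hsq : ((-1 : ℂ) ^ k)⁻¹ = (-1) ^ k := by rw [← inv_pow]; norm_num
    rw [gammaFactor, gammaNum, habs, hcast, Int.natAbs_neg, Int.natAbs_natCast, hI,
      Gamma_eq_of_sin_ne_zero h', hsin, show (1 : ℂ) - (s + k / 2) = 1 - s + -k / 2 by ring,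
      show (1 : ℂ) - s + k / 2 = 1 - s - -k / 2 by ring]
    simp only [div_eq_mul_inv, mul_inv, hsq]
    ring

theorem gammaFactor_sub_one {m : ℤ} {s : ℂ} (h : s - 1 + ((|m| : ℤ) : ℂ) / 2 ≠ 0) :
    gammaFactor m (s - 1) * ((s - 1 + ((|m| : ℤ) : ℂ) / 2) * (1 - s + ((|m| : ℤ) : ℂ) / 2))
      = (2 * Real.pi) ^ 2 * gammaFactor m s := by
  have h1 := Complex.Gamma_add_one _ h
  have h2 := Complex.one_div_Gamma_eq_self_mul_one_div_Gamma_add_one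
    (1 - s + ((|m| : ℤ) : ℂ) / 2)
  have h3 : ((2 * Real.pi : ℝ) : ℂ) ^ (1 - 2 * (s - 1))
      = (2 * Real.pi) ^ 2 * ((2 * Real.pi : ℝ) : ℂ) ^ (1 - 2 * s) := by
    rw [show 1 - 2 * (s - 1) = ((2 : ℕ) : ℂ) + (1 - 2 * s) by push_cast; ring,
      Complex.cpow_add _ _ ofReal_two_pi_ne_zero, Complex.cpow_natCast]
    push_cast
    ring
  rw [show s - 1 + ((|m| : ℤ) : ℂ) / 2 + 1 = s + ((|m| : ℤ) : ℂ) / 2 by ring] at h1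
  rw [show 1 - s + ((|m| : ℤ) : ℂ) / 2 + 1 = 1 - (s - 1) + ((|m| : ℤ) : ℂ) / 2 by ring] at h2
  rw [gammaFactor, gammaFactor, h3, div_eq_mul_inv (Gamma _), div_eq_mul_inv (Gamma _), h1, h2]
  ring

/-! ### Residues -/

/-- The pole `ν_l - |m_l| / 2 - j` of `G_(ν, m)`. -/
def pole {n : ℕ} (ν : Fin n → ℂ) (m : Fin n → ℤ) (l : Fin n) (j : ℕ) : ℂ :=
  ν l - ((|m l| : ℤ) : ℂ) / 2 - j

/-- The residue of `G_(ν, m)(s) x^(-2s)` at `s = ν_l - (j₁ + j₂) / 2`, where `j₁ - j₂ = m_l`. -/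
def residue {n : ℕ} (ν : Fin n → ℂ) (m : Fin n → ℤ) (x : ℝ) (l : Fin n) (j₁ j₂ : ℕ) : ℂ :=
  (∏ k, gammaNum (m k) (ν l - (j₁ + j₂) / 2 - ν k)) * (x : ℂ) ^ (-2 * (ν l - (j₁ + j₂) / 2))
    * (∏ k ∈ Finset.univ.erase l, (sin (Real.pi * (ν l - (j₁ + j₂) / 2 - ν k + m k / 2)))⁻¹)
    * ((-1) ^ j₂ * (Real.pi : ℂ)⁻¹)

/-- Genericity keeps the poles of different families apart. -/
theorem sin_ne_zero_of_generic {n : ℕ} {ν : Fin n → ℂ} {m : Fin n → ℤ} (hg : Generic ν m)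
    {l k : Fin n} (hlk : l ≠ k) {j₁ j₂ : ℕ} (hj : m l = j₁ - j₂) :
    sin (Real.pi * (ν l - (j₁ + j₂) / 2 - ν k + m k / 2)) ≠ 0 := by
  intro h
  rw [Complex.sin_eq_zero_iff] at h
  obtain ⟨z, hz⟩ := h
  have hpi : (Real.pi : ℂ) ≠ 0 := by exact_mod_cast Real.pi_ne_zero
  have hz' : ν l - (j₁ + j₂) / 2 - ν k + m k / 2 = z := by
    apply mul_left_cancel₀ hpi
    rw [hz]; ring
  refine hg l k hlk ?_
  obtain ⟨q, hq⟩ : ∃ q : ℤ, -(j₁ + j₂ : ℤ) + m k - 2 * z - |m k - m l| = 2 * q := by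
    rcases abs_cases (m k - m l) with ⟨h1, _⟩ | ⟨h1, _⟩
    · exact ⟨-j₂ - z, by rw [h1, hj]; ring⟩
    · exact ⟨m k - j₁ - z, by rw [h1, hj]; ring⟩
  refine ⟨q, ?_⟩
  have hq' : (-(j₁ + j₂ : ℂ) + m k - 2 * z - ((|m k - m l| : ℤ) : ℂ)) = 2 * q := by
    exact_mod_cast hq
  rw [← hq', ← hz']
  simp only
  ring

theorem tendsto_sub_mul_inv_sin (p : ℂ) :
    Tendsto (fun s => (s - p) * (sin (Real.pi * (s - p)))⁻¹) (𝓝[≠] p) (𝓝 (Real.pi : ℂ)⁻¹) ∧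
      ∀ᶠ s in 𝓝[≠] p, sin (Real.pi * (s - p)) ≠ 0 := by
  have hpi : (Real.pi : ℂ) ≠ 0 := by exact_mod_cast Real.pi_ne_zero
  have hd : HasDerivAt (fun s : ℂ => sin (Real.pi * (s - p))) (Real.pi : ℂ) p := by
    have h1 : HasDerivAt (fun s : ℂ => (Real.pi : ℂ) * (s - p)) (Real.pi : ℂ) p := by
      simpa using ((hasDerivAt_id p).sub_const p).const_mul (Real.pi : ℂ)
    have h2 := h1.csin
    simpa using h2
  refine ⟨?_, ?_⟩
  · have h1 := (hasDerivAt_iff_tendsto_slope.1 hd).inv₀ hpi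
    refine h1.congr fun s => ?_
    simp [slope_def_field, div_eq_mul_inv]
  · exact hd.eventually_ne hpi

/-- The residue of the integrand at a simple pole. -/
theorem tendsto_sub_mul_integrand {n : ℕ} {ν : Fin n → ℂ} {m : Fin n → ℤ} {x : ℝ} (hx : 0 < x)
    (hg : Generic ν m) {l : Fin n} {j₁ j₂ : ℕ} (hj : m l = j₁ - j₂) :
    Tendsto (fun s => (s - (ν l - (j₁ + j₂) / 2)) * integrand ν m x s)
      (𝓝[≠] (ν l - (j₁ + j₂) / 2)) (𝓝 (residue ν m x l j₁ j₂)) := by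
  set p : ℂ := ν l - (j₁ + j₂) / 2 with hp
  have hx' : (x : ℂ) ≠ 0 := by exact_mod_cast hx.ne'
  obtain ⟨hlim, hne⟩ := tendsto_sub_mul_inv_sin p
  have hl : ∀ s : ℂ, sin (Real.pi * (s - ν l + m l / 2)) = (-1) ^ j₂ * sin (Real.pi * (s - p)) := by
    intro s
    rw [show (Real.pi : ℂ) * (s - ν l + m l / 2) = Real.pi * (s - p) - (j₂ : ℕ) * Real.pi by
      rw [hp, hj]; push_cast; ring, Complex.sin_antiperiodic.sub_nat_mul_eq]
  have hk : ∀ k, k ≠ l → ContinuousAt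
      (fun s => (sin (Real.pi * (s - ν k + m k / 2)))⁻¹) p := fun k hkl =>
    ContinuousAt.inv₀ (by fun_prop) (sin_ne_zero_of_generic hg hkl.symm hj)
  have hkne : ∀ᶠ s in 𝓝[≠] p, ∀ k, k ≠ l → sin (Real.pi * (s - ν k + m k / 2)) ≠ 0 := by
    refine nhdsWithin_le_nhds (eventually_all.2 fun k => ?_)
    by_cases hkl : k = l
    · exact .of_forall fun s h => absurd hkl h
    · have hc : ContinuousAt (fun s => sin (Real.pi * (s - ν k + m k / 2))) p := by fun_prop
      filter_upwards [hc.eventually_ne (sin_ne_zero_of_generic hg (Ne.symm hkl) hj)] with s hs _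
      exact hs
  have hA : ContinuousAt (fun s => (∏ k, gammaNum (m k) (s - ν k)) * (x : ℂ) ^ (-2 * s)
      * ∏ k ∈ Finset.univ.erase l, (sin (Real.pi * (s - ν k + m k / 2)))⁻¹) p := by
    refine ContinuousAt.mul (ContinuousAt.mul ?_ ?_) ?_
    · refine (continuous_finsetProd _ fun k _ => ?_).continuousAt
      exact (continuous_gammaNum (m k)).comp (by fun_prop)
    · exact ContinuousAt.const_cpow (by fun_prop) (.inl hx')
    · exact tendsto_finsetProd _ fun k hk' => hk k (Finset.ne_of_mem_erase hk')
  have hmain := (hA.tendsto.mono_left (nhdsWithin_le_nhds (s := {p}ᶜ))).mul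
    (hlim.const_mul ((-1) ^ j₂))
  refine hmain.congr' ?_
  filter_upwards [hne, hkne] with s h1 h2
  have hsq : ((-1 : ℂ) ^ j₂)⁻¹ = (-1) ^ j₂ := by rw [← inv_pow]; norm_num
  have hl0 : sin (Real.pi * (s - ν l + m l / 2)) ≠ 0 := by
    rw [hl]
    exact mul_ne_zero (pow_ne_zero _ (by norm_num)) h1
  have hfac : ∀ k, gammaFactor (m k) (s - ν k)
      = gammaNum (m k) (s - ν k) * (sin (Real.pi * (s - ν k + m k / 2)))⁻¹ := by
    intro k
    by_cases hkl : k = l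
    · rw [hkl]; exact gammaFactor_eq hl0
    · exact gammaFactor_eq (h2 k hkl)
  rw [integrand, gammaProd, Finset.prod_congr rfl fun k _ => hfac k, Finset.prod_mul_distrib,
    ← Finset.mul_prod_erase Finset.univ (fun k => (sin (Real.pi * (s - ν k + m k / 2)))⁻¹)
      (Finset.mem_univ l), hl, mul_inv, hsq]
  ring

/-- The `j`-th pole is `ν_l - (j₁ + j₂) / 2` with `j₁ - j₂ = m_l` and `min j₁ j₂ = j`. -/
theorem pole_eq {n : ℕ} (ν : Fin n → ℂ) (m : Fin n → ℤ) (l : Fin n) (j : ℕ) :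
    pole ν m l j = ν l - (((m l).toNat + j : ℕ) + ((-m l).toNat + j : ℕ)) / 2 := by
  have h : (|m l| : ℤ) = (m l).toNat + (-m l).toNat := by
    rcases abs_cases (m l) with ⟨h1, _⟩ | ⟨h1, _⟩ <;> omega
  rw [pole, h]
  push_cast
  ring

theorem toNat_sub_toNat_neg_add (a : ℤ) (j : ℕ) :
    a = (((a.toNat + j : ℕ) : ℤ) - (((-a).toNat + j : ℕ) : ℤ)) := by
  omega

theorem pole_injective {n : ℕ} {ν : Fin n → ℂ} {m : Fin n → ℤ} (hg : Generic ν m)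
    {l k : Fin n} {i j : ℕ} (h : pole ν m l i = pole ν m k j) : l = k ∧ i = j := by
  by_cases hlk : l = k
  · subst hlk
    refine ⟨rfl, ?_⟩
    simp only [pole] at h
    exact_mod_cast sub_right_injective h
  · exfalso
    have h1 := sin_ne_zero_of_generic hg hlk (toNat_sub_toNat_neg_add (m l) i)
    rw [← pole_eq, h, pole_eq] at h1
    refine h1 ?_
    have hm : (m k : ℂ) = (((m k).toNat + j : ℕ) : ℂ) - (((-m k).toNat + j : ℕ) : ℂ) := by
      exact_mod_cast toNat_sub_toNat_neg_add (m k) j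
    rw [Complex.sin_eq_zero_iff]
    refine ⟨-(((-m k).toNat + j : ℕ) : ℤ), ?_⟩
    rw [hm]
    push_cast
    ring

/-! ### Shifting the contour to the left -/

/-- There is a vertical line of abscissa `-L`, as far to the left as desired, that has the rightmost
pole of each family to its right and, like all its translates by integers, avoids all poles. -/
theorem exists_abscissa {n : ℕ} (ν : Fin n → ℂ) (m : Fin n → ℤ) (B : ℝ) :
    ∃ L : ℝ, B < L ∧ ∀ l, 0 < (ν l).re - |(m l : ℝ)| / 2 + L ∧
      ∀ z : ℤ, (ν l).re - |(m l : ℝ)| / 2 + L ≠ z := by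
  obtain ⟨D, hD⟩ := (Set.finite_range fun l => |(m l : ℝ)| / 2 - (ν l).re).bddAbove
  have hcount : (⋃ l, range fun z : ℤ => (z : ℝ) - ((ν l).re - |(m l : ℝ)| / 2)).Countable :=
    countable_iUnion fun l => countable_range _
  obtain ⟨L, hL1, hL2⟩ := (hcount.dense_compl ℝ).exists_between
    (lt_add_one (max B D))
  refine ⟨L, (le_max_left _ _).trans_lt hL2.1, fun l => ⟨?_, fun z hz => hL1 ?_⟩⟩
  · have h1 := hD ⟨l, rfl⟩
    simp only at h1
    linarith [(le_max_right B D).trans_lt hL2.1]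
  · exact mem_iUnion.2 ⟨l, z, by simp only; linarith⟩

section Shift

variable {n : ℕ} {ν : Fin n → ℂ} {m : Fin n → ℤ} {x : ℝ}

/-- The functional equation `s ↦ s - 1` divides the integrand by a large polynomial far to the
left. -/
theorem integrand_sub_one_norm_le (hx : 0 < x) {s : ℂ} {N : ℝ} (hN : 0 < N)
    (h : ∀ l, (s - ν l + ((|m l| : ℤ) : ℂ) / 2).re ≤ 1 - N)
    (h' : ∀ l, N ≤ (1 - (s - ν l) + ((|m l| : ℤ) : ℂ) / 2).re) :
    ‖integrand ν m x (s - 1)‖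
      ≤ x ^ 2 * ((2 * Real.pi) ^ 2 / N ^ 2) ^ n * ‖integrand ν m x s‖ := by
  have hfac : ∀ l, ‖gammaFactor (m l) (s - 1 - ν l)‖
      ≤ (2 * Real.pi) ^ 2 / N ^ 2 * ‖gammaFactor (m l) (s - ν l)‖ := by
    intro l
    have h1 : N ≤ ‖s - ν l - 1 + ((|m l| : ℤ) : ℂ) / 2‖ := by
      refine le_trans ?_ (Complex.abs_re_le_norm _)
      have h2 := h l
      have e : (s - ν l - 1 + ((|m l| : ℤ) : ℂ) / 2).re
          = (s - ν l + ((|m l| : ℤ) : ℂ) / 2).re - 1 := by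
        simp only [add_re, sub_re, one_re]; ring
      rw [e, le_abs]
      right; linarith
    have h2 : N ≤ ‖1 - (s - ν l) + ((|m l| : ℤ) : ℂ) / 2‖ :=
      (h' l).trans ((le_abs_self _).trans (Complex.abs_re_le_norm _))
    have h0 : s - ν l - 1 + ((|m l| : ℤ) : ℂ) / 2 ≠ 0 := norm_pos_iff.1 (hN.trans_le h1)
    have h3 := congrArg norm (gammaFactor_sub_one h0)
    rw [norm_mul, norm_mul, norm_mul, norm_pow, norm_mul, Complex.norm_real,
      Real.norm_of_nonneg Real.pi_pos.le, RCLike.norm_ofNat] at h3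
    rw [show s - 1 - ν l = s - ν l - 1 by ring, div_mul_eq_mul_div, le_div_iff₀ (by positivity),
      ← h3, sq]
    gcongr
  rw [integrand, integrand, norm_mul, norm_mul, norm_cpow_neg_two_mul hx,
    norm_cpow_neg_two_mul hx, gammaProd, gammaProd, norm_prod, norm_prod]
  have h4 : x ^ (-2 * (s - 1).re) = x ^ 2 * x ^ (-2 * s.re) := by
    rw [← Real.rpow_natCast, ← Real.rpow_add hx]
    congr 1
    simp only [sub_re, one_re]
    push_cast; ring
  have h5 := Finset.prod_le_prod (s := Finset.univ)
    (fun l _ => norm_nonneg (gammaFactor (m l) (s - 1 - ν l))) fun l _ => hfac l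
  rw [Finset.prod_mul_distrib, Finset.prod_const, Finset.card_univ, Fintype.card_fin] at h5
  rw [h4]
  calc _ ≤ ((2 * Real.pi) ^ 2 / N ^ 2) ^ n * (∏ l, ‖gammaFactor (m l) (s - ν l)‖)
        * (x ^ 2 * x ^ (-2 * s.re)) := by gcongr
    _ = _ := by ring

/-- Integrability along a vertical line that avoids the poles. -/
theorem integrable_vertical (hn : 1 ≤ n) (hν : ν ∈ hyperplane n) (hx : 0 < x) {a ρ T : ℝ}
    (h : Admissible ν m a ρ T) (ha : ∀ t : ℝ, Regular ν m (a + t * I)) :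
    Integrable fun t : ℝ => integrand ν m x (a + t * I) := by
  have hc : Continuous fun t : ℝ => integrand ν m x (a + t * I) := by
    refine continuous_iff_continuousAt.2 fun t => ?_
    exact ContinuousAt.comp (f := fun t : ℝ => (a + t * I : ℂ))
      (differentiableAt_integrand hx (ha t)).continuousAt (by fun_prop)
  have h1 := (h.integrableOn_Iic hn hν hx).union
    ((hc.continuousOn.integrableOn_Icc (a := -T) (b := T)).union (h.integrableOn_Ioi hn hν hx))
  rw [← integrableOn_univ]
  refine h1.mono_set fun t _ => ?_
  rcases le_or_gt t (-T) with h2 | h2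
  · exact .inl h2
  · rcases le_or_gt t T with h3 | h3
    · exact .inr (.inl ⟨h2.le, h3⟩)
    · exact .inr (.inr h3)

theorem regular_of_noninteger {L : ℝ}
    (hL : ∀ l, ∀ z : ℤ, (ν l).re - |(m l : ℝ)| / 2 + L ≠ z) (N : ℕ) (t : ℝ) :
    Regular ν m ((-(L + N) : ℝ) + t * I) := by
  intro l j hj
  have h1 := congrArg Complex.re hj
  rw [add_re, sub_re, re_abs_div_two] at h1
  simp only [add_re, ofReal_re, mul_re, I_re, mul_zero, ofReal_im, I_im, mul_one, sub_self,
    add_zero, neg_re, natCast_re] at h1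
  refine hL l (j - N) ?_
  push_cast
  linarith

/-- The integrals along the vertical lines of abscissa `-(L + N)` tend to zero. -/
theorem tendsto_line_integral (hn : 1 ≤ n) (hν : ν ∈ hyperplane n) (hx : 0 < x) {L ρ T : ℝ}
    (hL : ∀ l, 0 < (ν l).re - |(m l : ℝ)| / 2 + L ∧
      ∀ z : ℤ, (ν l).re - |(m l : ℝ)| / 2 + L ≠ z)
    (h : ∀ N : ℕ, Admissible ν m (-(L + N)) ρ T) :
    Tendsto (fun N : ℕ => ∫ t : ℝ, integrand ν m x ((-(L + N) : ℝ) + t * I)) atTop (𝓝 0) := by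
  have hint : ∀ N : ℕ, Integrable fun t : ℝ => integrand ν m x ((-(L + N) : ℝ) + t * I) := fun N =>
    integrable_vertical hn hν hx (h N) (regular_of_noninteger (fun l => (hL l).2) N)
  set J : ℕ → ℝ := fun N => ∫ t : ℝ, ‖integrand ν m x ((-(L + N) : ℝ) + t * I)‖ with hJ
  have hJ0 : ∀ N, 0 ≤ J N := fun N => integral_nonneg fun t => norm_nonneg _
  have hstep : ∀ N : ℕ, J (N + 1)
      ≤ x ^ 2 * ((2 * Real.pi) ^ 2 / ((N : ℝ) + 1) ^ 2) ^ n * J N := by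
    intro N
    rw [hJ]
    simp only
    rw [← integral_const_mul]
    refine integral_mono (hint (N + 1)).norm ((hint N).norm.const_mul _) fun t => ?_
    have e : (((-(L + ((N + 1 : ℕ) : ℝ)) : ℝ) : ℂ) + t * I)
        = ((-(L + N) : ℝ) : ℂ) + t * I - 1 := by
      push_cast; ring
    simp only
    rw [e]
    refine integrand_sub_one_norm_le hx (by positivity) (fun l => ?_) fun l => ?_
    · rw [add_re, sub_re, re_abs_div_two]
      simp only [add_re, ofReal_re, mul_re, I_re, mul_zero, ofReal_im, I_im, mul_one, sub_self,
        add_zero]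
      linarith [(hL l).1]
    · rw [add_re, sub_re, sub_re, re_abs_div_two]
      simp only [add_re, ofReal_re, mul_re, I_re, mul_zero, ofReal_im, I_im, mul_one, sub_self,
        add_zero, one_re]
      linarith [(hL l).1, abs_nonneg (m l : ℝ)]
  have hq : Tendsto (fun N : ℕ => x ^ 2 * ((2 * Real.pi) ^ 2 / ((N : ℝ) + 1) ^ 2) ^ n) atTop
      (𝓝 0) := by
    have h1 : Tendsto (fun N : ℕ => ((N : ℝ) + 1) ^ 2) atTop atTop :=
      (tendsto_pow_atTop two_ne_zero).comp
        (tendsto_atTop_add_const_right _ _ tendsto_natCast_atTop_atTop)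
    have h2 := ((h1.const_div_atTop ((2 * Real.pi) ^ 2)).pow n).const_mul (x ^ 2)
    rwa [zero_pow (by omega), mul_zero] at h2
  have hsum : Summable J := by
    refine summable_of_ratio_norm_eventually_le (r := 1 / 2) (by norm_num) ?_
    filter_upwards [hq.eventually_le_const (by norm_num : (0 : ℝ) < 1 / 2)] with N hN
    rw [Real.norm_of_nonneg (hJ0 _), Real.norm_of_nonneg (hJ0 _)]
    exact (hstep N).trans (mul_le_mul_of_nonneg_right hN (hJ0 N))
  exact squeeze_zero_norm (fun N => norm_integral_le_integral_norm _) hsum.tendsto_atTop_zero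

/-- The contour integral is the line integral along an abscissa `-(L + N)` plus the residues
to the right of that line. -/
theorem contourIntegral_eq_line_add_residues (hn : 1 ≤ n) (hν : ν ∈ hyperplane n)
    (hg : Generic ν m) (hx : 0 < x) {σ ρ T L : ℝ} (h : Admissible ν m σ ρ T)
    (hLσ : -L ≤ σ) (hLρ : -L ≤ ρ)
    (hL : ∀ l, 0 < (ν l).re - |(m l : ℝ)| / 2 + L ∧
      ∀ z : ℤ, (ν l).re - |(m l : ℝ)| / 2 + L ≠ z) (N : ℕ) :
    contourIntegral σ ρ T (integrand ν m x)
      = I * (∫ t : ℝ, integrand ν m x ((-(L + N) : ℝ) + t * I))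
        + 2 * Real.pi * I * ∑ l, ∑ j ∈ Finset.range
            (⌈(ν l).re - |(m l : ℝ)| / 2 + L⌉₊ + N),
            residue ν m x l ((m l).toNat + j) ((-m l).toNat + j) := by
  classical
  have hT := h.T_pos hn
  have hN0 : (0 : ℝ) ≤ N := N.cast_nonneg
  set a : ℝ := -(L + N) with ha
  have haσ : a ≤ σ := by rw [ha]; linarith
  have haρ : a ≤ ρ := by rw [ha]; linarith
  have hn0 : (0 : ℝ) ≤ n := n.cast_nonneg
  have hadm : Admissible ν m a ρ T :=
    ⟨lt_of_le_of_lt (by gcongr) h.decay, h.lt_ρ, h.lt_T⟩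
  -- move the half lines
  obtain ⟨M, hM0, hMT, hM⟩ := h.exists_im_bound hn
  obtain ⟨A, hA⟩ := exists_re_bound ν
  obtain ⟨C, -, hC⟩ := norm_integrand_le m hx (A := max A (max |a| |σ|)) (σ := σ) hM0 hMT
  rw [contourIntegral_shift (σ' := a) (C := C) hT h.decay
    (fun s hs => differentiableAt_integrand hx (h.regular_im hs)) fun u hu t ht => by
      rw [uIcc_of_le haσ] at hu
      refine hC ν hν (fun l => (hA l).le.trans (le_max_left _ _)) (fun l => (hM l).le) u t
        (le_trans ?_ (le_max_right _ _)) hu.2 ht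
      exact abs_le_max_abs_abs hu.1 hu.2]
  rw [contourIntegral_eq_line_add_rect (integrable_vertical hn hν hx hadm
    (regular_of_noninteger (fun l => (hL l).2) N))]
  congr 1
  -- the poles inside the rectangle
  set c : Fin n → ℝ := fun l => (ν l).re - |(m l : ℝ)| / 2 + L with hc
  set S : Finset (Σ _ : Fin n, ℕ) :=
    Finset.univ.sigma fun l => Finset.range (⌈c l⌉₊ + N) with hS
  set f : (Σ _ : Fin n, ℕ) → ℂ := fun q => pole ν m q.1 q.2 with hf
  have hinj : ∀ q q', f q = f q' → q = q' := by
    rintro ⟨l, i⟩ ⟨k, j⟩ hq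
    obtain ⟨rfl, rfl⟩ := pole_injective hg hq
    rfl
  have hpre : ∀ l j, (pole ν m l j).re = c l - L - j := by
    intro l j
    rw [pole, sub_re, sub_re, re_abs_div_two, natCast_re, hc]
    ring
  have hpim : ∀ l j, (pole ν m l j).im = (ν l).im := by
    intro l j
    rw [pole, abs_div_two_eq_ofReal]
    simp
  have hres : ∀ l j, Tendsto (fun s => (s - pole ν m l j) * integrand ν m x s)
      (𝓝[≠] (pole ν m l j)) (𝓝 (residue ν m x l ((m l).toNat + j) ((-m l).toNat + j))) := by
    intro l j
    rw [pole_eq]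
    exact tendsto_sub_mul_integrand hx hg (toNat_sub_toNat_neg_add (m l) j)
  have hUo : IsOpen {s : ℂ | ∀ l, c l - L - (⌈c l⌉₊ + N : ℕ) < s.re} := by
    rw [Set.ofPred_forall]
    exact isOpen_iInter_of_finite fun l => isOpen_lt continuous_const continuous_re
  rw [rectIntegral_eq_sum_residues (S.image f)
    (r := fun p => limUnder (𝓝[≠] p) fun s => (s - p) * integrand ν m x s) hUo ?_ haρ
    (by linarith) ?_ ?_ ?_]
  · rw [Finset.sum_image fun q _ q' _ hq => hinj q q' hq, hS, Finset.sum_sigma]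
    congr 1
    exact Finset.sum_congr rfl fun l _ => Finset.sum_congr rfl fun j _ => (hres l j).limUnder_eq
  · rintro s hs l
    rw [mem_reProdIm] at hs
    have h1 : a ≤ s.re := hs.1.1
    have h2 : c l ≤ ⌈c l⌉₊ := Nat.le_ceil _
    have h3 : c l ≠ ⌈c l⌉₊ := fun h0 => (hL l).2 ⌈c l⌉₊ (by simpa [hc] using h0)
    have h4 : c l < ⌈c l⌉₊ := lt_of_le_of_ne h2 h3
    rw [ha] at h1
    push_cast
    linarith
  · rintro s ⟨hs1, hs2⟩
    refine (differentiableAt_integrand hx fun l j hj => hs2 ?_).differentiableWithinAt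
    have hsp : s = pole ν m l j := by
      rw [pole]
      linear_combination hj
    have h1 := hs1 l
    rw [hsp, hpre] at h1
    have h2 : j < ⌈c l⌉₊ + N := by
      have : (j : ℝ) < ((⌈c l⌉₊ + N : ℕ) : ℝ) := by linarith
      exact_mod_cast this
    rw [hsp]
    exact Finset.mem_coe.2 (Finset.mem_image.2 ⟨⟨l, j⟩, by simp [hS, h2], rfl⟩)
  · intro p hp
    obtain ⟨⟨l, j⟩, hq, rfl⟩ := Finset.mem_image.1 hp
    simp only [hS, Finset.mem_sigma, Finset.mem_univ, Finset.mem_range, true_and] at hq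
    rw [mem_reProdIm, hf]
    simp only [hpre, hpim, mem_Ioo]
    have h1 := h.lt_ρ l
    rw [Int.cast_abs] at h1
    have h2 := abs_lt.1 (h.lt_T l)
    have hj0 : (0 : ℝ) ≤ j := j.cast_nonneg
    have hcl : 0 < c l := (hL l).1
    have h3 : (j : ℝ) < c l + N := by
      rcases le_or_gt N j with hNj | hNj
      · have h4 : j - N < ⌈c l⌉₊ := by omega
        rw [Nat.lt_ceil, Nat.cast_sub hNj] at h4
        linarith
      · have : (j : ℝ) < N := by exact_mod_cast hNj
        linarith
    refine ⟨⟨?_, ?_⟩, h2.1, h2.2⟩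
    · rw [ha]; linarith
    · simp only [hc]; linarith
  · intro p hp
    obtain ⟨⟨l, j⟩, -, rfl⟩ := Finset.mem_image.1 hp
    exact tendsto_nhds_limUnder ⟨_, hres l j⟩

/-- For a generic index the contour integral is the sum of all residues to its left. -/
theorem tendsto_sum_residues (hn : 1 ≤ n) (hν : ν ∈ hyperplane n)
    (hg : Generic ν m) (hx : 0 < x) {σ ρ T : ℝ} (h : Admissible ν m σ ρ T) :
    ∃ A : Fin n → ℕ, Tendsto (fun N : ℕ => 2 * Real.pi * I * ∑ l, ∑ j ∈ Finset.range (A l + N),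
      residue ν m x l ((m l).toNat + j) ((-m l).toNat + j)) atTop
      (𝓝 (contourIntegral σ ρ T (integrand ν m x))) := by
  obtain ⟨L, hLB, hL⟩ := exists_abscissa ν m (max (-σ) (-ρ))
  have hLσ : -L ≤ σ := by linarith [(le_max_left (-σ) (-ρ)).trans_lt hLB]
  have hLρ : -L ≤ ρ := by linarith [(le_max_right (-σ) (-ρ)).trans_lt hLB]
  have hadm : ∀ N : ℕ, Admissible ν m (-(L + N)) ρ T := fun N => by
    refine ⟨lt_of_le_of_lt ?_ h.decay, h.lt_ρ, h.lt_T⟩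
    have : (0 : ℝ) ≤ N := N.cast_nonneg
    gcongr
    linarith
  have hlim := ((tendsto_line_integral hn hν hx hL hadm).const_mul I).const_sub
    (contourIntegral σ ρ T (integrand ν m x))
  rw [mul_zero, sub_zero] at hlim
  refine ⟨fun l => ⌈(ν l).re - |(m l : ℝ)| / 2 + L⌉₊, hlim.congr fun N => ?_⟩
  rw [contourIntegral_eq_line_add_residues hn hν hg hx h hLσ hLρ hL N]
  ring

end Shift

/-! ### The power series of the Bessel functions of the first kind -/

/-- The `j`-th term of the series `J_l(z; +, lam)` at `z = r e^{iω}`. -/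
def firstKindTerm {n : ℕ} (lam : Fin n → ℂ) (l : Fin n) (r ω : ℝ) (j : ℕ) : ℂ :=
  ((((1 : ℤˣ) : ℤ) : ℂ) * I ^ n) ^ j * coverPow r ω ((n : ℂ) * (-lam l + j))
    / ∏ k, Gamma (lam k - lam l + j + 1)

theorem firstKind_eq_tsum {n : ℕ} (lam : Fin n → ℂ) (l : Fin n) (r ω : ℝ) :
    firstKind 1 lam l r ω = ∑' j, firstKindTerm lam l r ω j := rfl

/-- The recurrence between consecutive terms, written without division because the reciprocal Gamma
function satisfies its functional equation at the poles too. -/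
theorem firstKindTerm_succ {n : ℕ} (lam : Fin n → ℂ) (l : Fin n) (r ω : ℝ) (j : ℕ) :
    firstKindTerm lam l r ω (j + 1) * ∏ k, (lam k - lam l + j + 1)
      = I ^ n * coverPow r ω n * firstKindTerm lam l r ω j := by
  have h1 : ∀ k, (Gamma (lam k - lam l + j + 1))⁻¹
      = (lam k - lam l + j + 1) * (Gamma (lam k - lam l + (j + 1 : ℕ) + 1))⁻¹ := by
    intro k
    rw [Complex.one_div_Gamma_eq_self_mul_one_div_Gamma_add_one]
    congr 3
    push_cast; ring
  have h2 : coverPow r ω ((n : ℂ) * (-lam l + (j + 1 : ℕ)))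
      = coverPow r ω n * coverPow r ω ((n : ℂ) * (-lam l + j)) := by
    rw [coverPow, coverPow, coverPow, ← Complex.exp_add]
    congr 1
    push_cast; ring
  simp only [firstKindTerm, div_eq_mul_inv, ← Finset.prod_inv_distrib]
  rw [Finset.prod_congr rfl fun k _ => h1 k, Finset.prod_mul_distrib, h2, pow_succ]
  simp only [Units.val_one, Int.cast_one, one_mul]
  ring

theorem summable_norm_firstKindTerm {n : ℕ} (lam : Fin n → ℂ) (l : Fin n) (r ω : ℝ) :
    Summable fun j => ‖firstKindTerm lam l r ω j‖ := by
  have hbig : ∀ k, ∀ᶠ j : ℕ in atTop, 1 ≤ ‖lam k - lam l + j + 1‖ := by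
    intro k
    filter_upwards [eventually_ge_atTop ⌈‖lam k - lam l‖⌉₊] with j hj
    have h1 : ‖lam k - lam l‖ ≤ j := (Nat.le_ceil _).trans (by exact_mod_cast hj)
    have h2 : ‖((j + 1 : ℕ) : ℂ)‖ ≤ ‖lam k - lam l + j + 1‖ + ‖lam k - lam l‖ := by
      have e : ((j + 1 : ℕ) : ℂ) = lam k - lam l + j + 1 - (lam k - lam l) := by
        push_cast; ring
      rw [e]
      exact norm_sub_le _ _
    rw [Complex.norm_natCast] at h2
    push_cast at h2
    linarith
  set q : ℝ := ‖I ^ n * coverPow r ω n‖ with hq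
  have hq0 : 0 ≤ q := norm_nonneg _
  refine (summable_of_ratio_norm_eventually_le (r := 1 / 2)
    (f := fun j => ‖firstKindTerm lam l r ω j‖) (by norm_num) ?_)
  filter_upwards [eventually_all.2 hbig, eventually_ge_atTop ⌈2 * q⌉₊] with j hj hjq
  have h1 : 2 * q ≤ j := (Nat.le_ceil _).trans (by exact_mod_cast hjq)
  have h2 := congrArg norm (firstKindTerm_succ lam l r ω j)
  rw [norm_mul, norm_mul, norm_prod, ← hq] at h2
  have h3 : (j : ℝ) + 1 ≤ ∏ k, ‖lam k - lam l + j + 1‖ := by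
    rw [← Finset.mul_prod_erase Finset.univ _ (Finset.mem_univ l)]
    have e : ‖lam l - lam l + j + 1‖ = (j : ℝ) + 1 := by
      rw [sub_self, zero_add, ← Nat.cast_add_one, Complex.norm_natCast, Nat.cast_add_one]
    rw [e]
    refine le_mul_of_one_le_right (by positivity) ?_
    calc (1 : ℝ) = ∏ k ∈ Finset.univ.erase l, 1 := by simp
      _ ≤ _ := Finset.prod_le_prod (fun _ _ => zero_le_one) fun k _ => hj k
  simp only [norm_norm]
  have h4 := norm_nonneg (firstKindTerm lam l r ω (j + 1))
  have h5 := norm_nonneg (firstKindTerm lam l r ω j)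
  have h6 : ‖firstKindTerm lam l r ω (j + 1)‖ * ((j : ℝ) + 1)
      ≤ q * ‖firstKindTerm lam l r ω j‖ := by
    rw [← h2]; gcongr
  have hj1 : (0 : ℝ) < (j : ℝ) + 1 := by positivity
  refine le_of_mul_le_mul_right (h6.trans ?_) hj1
  nlinarith

/-! ### The residues as products of power series coefficients -/

theorem sin_add_int_mul_pi (z : ℂ) (M : ℤ) :
    sin (z + M * Real.pi) = (-1) ^ M * sin z := by
  rcases Int.eq_nat_or_neg M with ⟨k, rfl | rfl⟩
  · rw [Int.cast_natCast, Complex.sin_antiperiodic.add_nat_mul_eq, zpow_natCast]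
  · have h : z + ((-(k : ℤ) : ℤ) : ℂ) * Real.pi = z - (k : ℕ) * Real.pi := by
      push_cast; ring
    rw [h, Complex.sin_antiperiodic.sub_nat_mul_eq, zpow_neg, zpow_natCast, ← inv_pow]
    norm_num

/-- The coefficient `S_l` does not depend on the sign. -/
theorem coeffS_eq_neg {n : ℕ} (ε : ℤˣ) (μ : Fin n → ℂ) (m : Fin n → ℤ) (l : Fin n) :
    coeffS ε μ m l = ∏ k ∈ Finset.univ.erase l,
      ((-I) ^ (m l - m k) * (sin (Real.pi * (μ l - μ k - ((m l : ℂ) - m k) / 2)))⁻¹) := by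
  refine Finset.prod_congr rfl fun k _ => ?_
  rcases Int.units_eq_one_or ε with rfl | rfl
  · have h : (Real.pi : ℂ) * (μ l - μ k + (((1 : ℤˣ) : ℤ) : ℂ) * (((m l - m k : ℤ) : ℂ) / 2))
        = Real.pi * (μ l - μ k - ((m l : ℂ) - m k) / 2) + (m l - m k : ℤ) * Real.pi := by
      push_cast; ring
    have hsq : ((-1 : ℂ) ^ (m l - m k))⁻¹ = (-1) ^ (m l - m k) := by rw [← inv_zpow]; norm_num
    have hI : (-I) ^ (m l - m k) = (-1) ^ (m l - m k) * I ^ (m l - m k) := by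
      rw [← mul_zpow, neg_one_mul]
    rw [h, sin_add_int_mul_pi, div_eq_mul_inv, mul_inv, hsq, hI]
    simp only [Units.val_one, Int.cast_one, one_mul]
    ring
  · rw [div_eq_mul_inv]
    congr 2
    · simp
    · congr 2
      push_cast
      ring

theorem coverPow_mul_coverPow {n : ℕ} (hn : 1 ≤ n) {x φ : ℝ} (hx : 0 < x) (w : ℂ) (M κ : ℤ)
    (j₁ j₂ : ℕ) (hκ : M + κ = j₁ - j₂) :
    coverPow (2 * Real.pi * x ^ (1 / (n : ℝ))) (φ / n) (n * (-(w + M / 2) + j₁))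
        * coverPow (2 * Real.pi * x ^ (1 / (n : ℝ))) (-(φ / n)) (n * (-(w - M / 2) + j₂))
      = ((2 * Real.pi : ℝ) : ℂ) ^ (-2 * n * (w - (j₁ + j₂) / 2))
        * (x : ℂ) ^ (-2 * (w - (j₁ + j₂) / 2)) * exp (φ * I) ^ κ := by
  have hx' : (x : ℂ) ≠ 0 := by exact_mod_cast hx.ne'
  have hn' : (n : ℂ) ≠ 0 := by exact_mod_cast (by omega : n ≠ 0)
  have hpi := Real.pi_pos
  have hlog : ((Real.log (2 * Real.pi * x ^ (1 / (n : ℝ))) : ℝ) : ℂ)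
      = (Real.log (2 * Real.pi) : ℝ) + (Real.log x : ℝ) / n := by
    rw [Real.log_mul (by positivity) (by positivity), Real.log_rpow hx]
    push_cast
    ring
  have hκ' : (κ : ℂ) = j₁ - j₂ - M := by
    have : (M : ℂ) + κ = j₁ - j₂ := by exact_mod_cast hκ
    linear_combination this
  rw [coverPow, coverPow, ← Complex.exp_add, Complex.cpow_def_of_ne_zero ofReal_two_pi_ne_zero,
    Complex.cpow_def_of_ne_zero hx', ← Complex.ofReal_log (by positivity),
    ← Complex.ofReal_log hx.le, ← Complex.exp_int_mul, ← Complex.exp_add, ← Complex.exp_add,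
    hlog, hκ']
  congr 1
  push_cast
  field_simp
  ring

theorem I_zpow_mul_neg_one_pow (j₁ j₂ : ℕ) :
    I ^ ((j₁ : ℤ) - j₂) * (-1) ^ j₂ = I ^ j₁ * I ^ j₂ := by
  rw [zpow_sub₀ I_ne_zero, zpow_natCast, zpow_natCast, div_eq_mul_inv, mul_assoc, ← inv_pow,
    inv_I, ← mul_pow, neg_mul_neg, mul_one]

theorem shift_generic {n : ℕ} {ν : Fin n → ℂ} {m : Fin n → ℤ} (hg : Generic ν m) (κ : ℤ) :
    Generic ν (shift m κ) := by
  intro l k hlk h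
  refine hg l k hlk ?_
  simpa [Sim, shift] using h

/-- The residues of `G_(ν, m + κ e)(s) x^(-2s)` are, up to constants, the products of the terms of
the two power series of Bessel functions of the first kind. -/
theorem residue_eq {n : ℕ} (hn : 1 ≤ n) {ν : Fin n → ℂ} (hν : ν ∈ hyperplane n) {m : Fin n → ℤ}
    {x : ℝ} (hx : 0 < x) (φ : ℝ) (ε : ℤˣ) (l : Fin n) (κ : ℤ) (j₁ j₂ : ℕ)
    (hj : shift m κ l = j₁ - j₂) :
    1 / (2 * Real.pi) * (residue ν (shift m κ) x l j₁ j₂ * exp (φ * I) ^ κ)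
      = (2 * (Real.pi : ℂ) ^ 2) ^ (n - 1) * (coeffS ε ν m l
        * (firstKindTerm (fun k => ν k + (m k : ℂ) / 2) l
            (2 * Real.pi * x ^ (1 / (n : ℝ))) (φ / n) j₁
          * firstKindTerm (fun k => ν k - (m k : ℂ) / 2) l
            (2 * Real.pi * x ^ (1 / (n : ℝ))) (-(φ / n)) j₂)) := by
  have hpi : (Real.pi : ℂ) ≠ 0 := by exact_mod_cast Real.pi_ne_zero
  have hj' : (m l : ℤ) + κ = j₁ - j₂ := hj
  have hκ : (κ : ℂ) = j₁ - j₂ - m l := by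
    have : (m l : ℂ) + κ = j₁ - j₂ := by exact_mod_cast hj'
    linear_combination this
  set p : ℂ := ν l - (j₁ + j₂) / 2 with hp
  -- the numerators
  have hnum : ∀ k, gammaNum (shift m κ k) (p - ν k)
      = I ^ (shift m κ k) * (Real.pi * ((2 * Real.pi : ℝ) : ℂ) ^ (1 - 2 * (p - ν k))
        * ((Gamma (ν k + (m k : ℂ) / 2 - (ν l + (m l : ℂ) / 2) + j₁ + 1))⁻¹
        * (Gamma (ν k - (m k : ℂ) / 2 - (ν l - (m l : ℂ) / 2) + j₂ + 1))⁻¹)) := by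
    intro k
    have e1 : (1 : ℂ) - (p - ν k) - (shift m κ k : ℤ) / 2
        = ν k - (m k : ℂ) / 2 - (ν l - (m l : ℂ) / 2) + j₂ + 1 := by
      rw [shift, hp]; push_cast; rw [hκ]; ring
    have e2 : (1 : ℂ) - (p - ν k) + (shift m κ k : ℤ) / 2
        = ν k + (m k : ℂ) / 2 - (ν l + (m l : ℂ) / 2) + j₁ + 1 := by
      rw [shift, hp]; push_cast; rw [hκ]; ring
    rw [gammaNum, e1, e2]
    ring
  have hcpow : ∏ k, ((2 * Real.pi : ℝ) : ℂ) ^ (1 - 2 * (p - ν k))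
      = (2 * Real.pi) ^ n * ((2 * Real.pi : ℝ) : ℂ) ^ (-2 * n * p) := by
    have hs : ∑ k, ν k = 0 := hν
    have e : ((2 * Real.pi : ℝ) : ℂ) ^ n = ((2 * Real.pi : ℝ) : ℂ) ^ (n : ℂ) :=
      (Complex.cpow_natCast _ _).symm
    rw [show (2 * (Real.pi : ℂ)) ^ n = ((2 * Real.pi : ℝ) : ℂ) ^ n by push_cast; rfl, e,
      ← Complex.cpow_add _ _ ofReal_two_pi_ne_zero]
    simp only [Complex.cpow_def_of_ne_zero ofReal_two_pi_ne_zero, ← Complex.exp_sum]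
    congr 1
    rw [← Finset.mul_sum]
    congr 1
    rw [Finset.sum_sub_distrib, ← Finset.mul_sum, Finset.sum_sub_distrib, hs]
    simp
    ring
  -- the powers of `i` and the sines
  have hsin : ∀ k ∈ Finset.univ.erase l, I ^ (shift m κ k)
        * (sin (Real.pi * (p - ν k + (shift m κ k : ℤ) / 2)))⁻¹
      = I ^ j₁ * I ^ j₂ * ((-I) ^ (m l - m k)
        * (sin (Real.pi * (ν l - ν k - ((m l : ℂ) - m k) / 2)))⁻¹) := by
    intro k _
    have e1 : (Real.pi : ℂ) * (p - ν k + (shift m κ k : ℤ) / 2)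
        = Real.pi * (ν l - ν k - ((m l : ℂ) - m k) / 2) - (j₂ : ℕ) * Real.pi := by
      rw [shift, hp]; push_cast; rw [hκ]; ring
    have e2 : I ^ (shift m κ k) = I ^ ((j₁ : ℤ) - j₂) * (-I) ^ (m l - m k) := by
      rw [← inv_I, inv_zpow, ← zpow_neg, ← zpow_add₀ I_ne_zero]
      congr 1
      rw [shift]; linarith
    have hsq : ((-1 : ℂ) ^ j₂)⁻¹ = (-1) ^ j₂ := by rw [← inv_pow]; norm_num
    rw [e1, Complex.sin_antiperiodic.sub_nat_mul_eq, mul_inv, hsq, e2,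
      ← I_zpow_mul_neg_one_pow]
    ring
  have hI : (∏ k, I ^ (shift m κ k))
      * ((∏ k ∈ Finset.univ.erase l, (sin (Real.pi * (p - ν k + (shift m κ k : ℤ) / 2)))⁻¹)
        * (-1) ^ j₂) = (I ^ j₁ * I ^ j₂) ^ n * coeffS ε ν m l := by
    rw [← Finset.mul_prod_erase Finset.univ (fun k => I ^ (shift m κ k)) (Finset.mem_univ l), hj,
      coeffS_eq_neg]
    calc _ = (I ^ ((j₁ : ℤ) - j₂) * (-1) ^ j₂) * ∏ k ∈ Finset.univ.erase l, (I ^ (shift m κ k)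
          * (sin (Real.pi * (p - ν k + (shift m κ k : ℤ) / 2)))⁻¹) := by
          rw [Finset.prod_mul_distrib]; ring
      _ = _ := by
          rw [Finset.prod_congr rfl hsin, Finset.prod_mul_distrib, Finset.prod_const,
            Finset.card_erase_of_mem (Finset.mem_univ l), Finset.card_univ, Fintype.card_fin,
            I_zpow_mul_neg_one_pow, ← mul_assoc, mul_pow_sub_one (by omega)]
  have hcov := coverPow_mul_coverPow hn (φ := φ) hx (ν l) (m l) κ j₁ j₂ hj'
  rw [← hp] at hcov
  have hconst : (2 * (Real.pi : ℂ)) ^ n * Real.pi ^ n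
      = (2 * (Real.pi : ℂ) ^ 2) ^ (n - 1) * (2 * Real.pi * Real.pi) := by
    rw [← mul_pow, show (2 * (Real.pi : ℂ)) * Real.pi = 2 * (Real.pi : ℂ) ^ 2 by ring,
      pow_sub_one_mul (by omega)]
  simp only [firstKindTerm, div_eq_mul_inv, ← Finset.prod_inv_distrib, Units.val_one,
    Int.cast_one, one_mul] at hcov hnum ⊢
  simp only [div_eq_mul_inv] at hI
  rw [residue]
  simp only [div_eq_mul_inv] at hp ⊢
  rw [← hp, Finset.prod_congr rfl fun k _ => hnum k]
  simp only [Finset.prod_mul_distrib, Finset.prod_const, Finset.card_univ, Fintype.card_fin]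
  rw [hcpow]
  have hIn : (I ^ n) ^ j₁ * (I ^ n) ^ j₂ = (I ^ j₁ * I ^ j₂) ^ n := by
    rw [mul_pow, ← pow_mul, ← pow_mul, ← pow_mul, ← pow_mul, mul_comm n, mul_comm n]
  have hconst' : (2 * (Real.pi : ℂ))⁻¹ * (Real.pi : ℂ)⁻¹ * ((2 * Real.pi) ^ n * Real.pi ^ n)
      = (2 * (Real.pi : ℂ) ^ 2) ^ (n - 1) := by
    rw [hconst]
    field_simp
  clear hnum hsin hcpow hconst
  generalize (∏ k, I ^ shift m κ k) = PI at hI ⊢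
  generalize (∏ k ∈ Finset.univ.erase l,
    (sin (Real.pi * (p - ν k + ((shift m κ k : ℤ) : ℂ) * 2⁻¹)))⁻¹) = PS at hI ⊢
  generalize (∏ k, (Gamma (ν k + (m k : ℂ) * 2⁻¹ - (ν l + (m l : ℂ) * 2⁻¹) + j₁ + 1))⁻¹) = G₁
  generalize (∏ k, (Gamma (ν k - (m k : ℂ) * 2⁻¹ - (ν l - (m l : ℂ) * 2⁻¹) + j₂ + 1))⁻¹) = G₂
  generalize coverPow (2 * Real.pi * x ^ (n : ℝ)⁻¹) (φ * (n : ℝ)⁻¹)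
    (n * (-(ν l + (m l : ℂ) * 2⁻¹) + j₁)) = c₁ at hcov ⊢
  generalize coverPow (2 * Real.pi * x ^ (n : ℝ)⁻¹) (-(φ * (n : ℝ)⁻¹))
    (n * (-(ν l - (m l : ℂ) * 2⁻¹) + j₂)) = c₂ at hcov ⊢
  generalize ((2 * Real.pi : ℝ) : ℂ) ^ (-2 * n * p) = P at hcov ⊢
  generalize (x : ℂ) ^ (-2 * p) = X at hcov ⊢
  generalize exp (φ * I) ^ κ = E at hcov ⊢
  generalize (I ^ j₁ * I ^ j₂) ^ n = W at hI hIn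
  generalize (2 * (Real.pi : ℂ) ^ 2) ^ (n - 1) = K at hconst' ⊢
  linear_combination
    ((2 * (Real.pi : ℂ))⁻¹ * (Real.pi : ℂ)⁻¹ * ((2 * Real.pi) ^ n * Real.pi ^ n)
      * P * X * E * G₁ * G₂) * hI + (W * coeffS ε ν m l * P * X * E * G₁ * G₂) * hconst'
    - (K * W * coeffS ε ν m l * G₁ * G₂) * hcov - (K * coeffS ε ν m l * c₁ * c₂ * G₁ * G₂) * hIn

/-! ### The connection formula for generic indices -/

/-- The bijection `(κ, α) ↦ (j₁, j₂)` with `j₁ - j₂ = a + κ` and `min j₁ j₂ = α`. -/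
def indexEquiv (a : ℤ) : ℤ × ℕ ≃ ℕ × ℕ where
  toFun q := ((a + q.1).toNat + q.2, (-(a + q.1)).toNat + q.2)
  invFun j := ((j.1 : ℤ) - j.2 - a, min j.1 j.2)
  left_inv := by
    rintro ⟨κ, α⟩
    ext <;> simp only <;> omega
  right_inv := by
    rintro ⟨i, j⟩
    ext <;> simp only <;> omega

/-- The residue of `G_(ν, m + κ e)(s) x^(-2s)` at its `α`-th pole of the `l`-th family. -/
def residueAt {n : ℕ} (ν : Fin n → ℂ) (m : Fin n → ℤ) (x : ℝ) (l : Fin n) (κ : ℤ) (α : ℕ) : ℂ :=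
  residue ν (shift m κ) x l ((shift m κ l).toNat + α) ((-shift m κ l).toNat + α)

section Generic

variable {n : ℕ} {ν : Fin n → ℂ} {m : Fin n → ℤ} {x : ℝ}

/-- Summing the residues of one family over all `κ` gives the product of the two power series. -/
theorem hasSum_residueAt (hn : 1 ≤ n) (hν : ν ∈ hyperplane n) (hx : 0 < x) (φ : ℝ) (ε : ℤˣ)
    (l : Fin n) :
    HasSum (fun q : ℤ × ℕ => 1 / (2 * Real.pi) * (residueAt ν m x l q.1 q.2 * exp (φ * I) ^ q.1))
      ((2 * (Real.pi : ℂ) ^ 2) ^ (n - 1) * (coeffS ε ν m l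
        * (firstKind 1 (fun k => ν k + (m k : ℂ) / 2) l
            (2 * Real.pi * x ^ (1 / (n : ℝ))) (φ / n)
          * firstKind 1 (fun k => ν k - (m k : ℂ) / 2) l
            (2 * Real.pi * x ^ (1 / (n : ℝ))) (-(φ / n))))) := by
  have hA := summable_norm_firstKindTerm (fun k => ν k + (m k : ℂ) / 2) l
    (2 * Real.pi * x ^ (1 / (n : ℝ))) (φ / n)
  have hB := summable_norm_firstKindTerm (fun k => ν k - (m k : ℂ) / 2) l
    (2 * Real.pi * x ^ (1 / (n : ℝ))) (-(φ / n))
  have h1 := ((summable_mul_of_summable_norm hA hB).hasSum.mul_left (coeffS ε ν m l)).mul_left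
    ((2 * (Real.pi : ℂ) ^ 2) ^ (n - 1))
  rw [← tsum_mul_tsum_of_summable_norm hA hB, ← firstKind_eq_tsum, ← firstKind_eq_tsum] at h1
  refine ((indexEquiv (m l)).hasSum_iff.2 h1).congr_fun fun q => ?_
  exact residue_eq hn hν hx φ ε l q.1 _ _ (toNat_sub_toNat_neg_add (shift m q.1 l) q.2)

theorem summable_residueAt (hn : 1 ≤ n) (hν : ν ∈ hyperplane n) (hx : 0 < x) (l : Fin n) (κ : ℤ) :
    Summable (residueAt ν m x l κ) := by
  have h := (hasSum_residueAt (m := m) hn hν hx 0 1 l).summable.prod_factor κ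
  have hpi : (1 / (2 * Real.pi) : ℂ) ≠ 0 := by
    have : (Real.pi : ℂ) ≠ 0 := by exact_mod_cast Real.pi_ne_zero
    simp [this]
  refine (summable_mul_left_iff hpi).1 ?_
  simpa using h

/-- The residue expansion of the contour integral for a generic index. -/
theorem contourIntegral_eq_tsum (hn : 1 ≤ n) (hν : ν ∈ hyperplane n) (hg : Generic ν m)
    (hx : 0 < x) {κ : ℤ} {σ ρ T : ℝ} (h : Admissible ν (shift m κ) σ ρ T) :
    contourIntegral σ ρ T (integrand ν (shift m κ) x)
      = 2 * Real.pi * I * ∑ l, ∑' α, residueAt ν m x l κ α := by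
  obtain ⟨A, hA⟩ := tendsto_sum_residues hn hν (shift_generic hg κ) hx h
  refine tendsto_nhds_unique hA (Tendsto.const_mul _ (tendsto_finsetSum _ fun l _ => ?_))
  refine (summable_residueAt hn hν hx l κ).hasSum.tendsto_sum_nat.comp ?_
  exact tendsto_atTop_mono (fun N => Nat.le_add_left N (A l)) tendsto_id

/-- The connection formula for generic indices, for arbitrary admissible contours. -/
theorem connectionSum_eq_tsum (hn : 1 ≤ n) (hν : ν ∈ hyperplane n) (hg : Generic ν m)
    (hx : 0 < x) {σ ρ T : ℤ → ℝ} (h : ∀ κ, Admissible ν (shift m κ) (σ κ) (ρ κ) (T κ)) (φ : ℝ)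
    (ε : ℤˣ) :
    1 / (2 * Real.pi) * ∑' κ : ℤ, 1 / (2 * Real.pi * I)
        * contourIntegral (σ κ) (ρ κ) (T κ) (integrand ν (shift m κ) x) * exp (φ * I) ^ κ
      = connectionSum ε ν m x φ := by
  have hpi : (Real.pi : ℂ) ≠ 0 := by exact_mod_cast Real.pi_ne_zero
  have hsum := fun l => hasSum_residueAt (m := m) hn hν hx φ ε l
  have hinner : ∀ l κ, ∑' α, (1 / (2 * Real.pi) : ℂ) * (residueAt ν m x l κ α * exp (φ * I) ^ κ)
      = 1 / (2 * Real.pi) * ((∑' α, residueAt ν m x l κ α) * exp (φ * I) ^ κ) := by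
    intro l κ
    rw [tsum_mul_left, tsum_mul_right]
  rw [connectionSum, Finset.mul_sum, ← tsum_mul_left]
  have h1 : ∀ l, ∑' κ : ℤ, 1 / (2 * Real.pi) * ((∑' α, residueAt ν m x l κ α) * exp (φ * I) ^ κ)
      = (2 * (Real.pi : ℂ) ^ 2) ^ (n - 1) * (coeffS ε ν m l
        * (firstKind 1 (fun k => ν k + (m k : ℂ) / 2) l
            (2 * Real.pi * x ^ (1 / (n : ℝ))) (φ / n)
          * firstKind 1 (fun k => ν k - (m k : ℂ) / 2) l
            (2 * Real.pi * x ^ (1 / (n : ℝ))) (-(φ / n)))) := by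
    intro l
    rw [← (hsum l).tsum_eq, (hsum l).summable.tsum_prod]
    exact tsum_congr fun κ => (hinner l κ).symm
  rw [← Finset.sum_congr rfl fun l _ => h1 l, ← Summable.tsum_finsetSum fun l _ => ?_]
  · refine tsum_congr fun κ => ?_
    rw [contourIntegral_eq_tsum hn hν hg hx (h κ), ← Finset.mul_sum, ← Finset.sum_mul]
    field_simp
  · refine (hsum l).summable.prod.congr fun κ => ?_
    exact (hinner l κ)

end Generic

/-! ### Arbitrary indices as limits of generic ones -/

/-- Generic indices in the hyperplane are dense: on the line `μ + t v` through `μ`, where the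
coordinates of `v` are distinct, only countably many `t` are excluded. -/
theorem neBot_nhdsWithin_genericSet {n : ℕ} {μ : Fin n → ℂ} (hμ : μ ∈ hyperplane n)
    (m : Fin n → ℤ) : (𝓝[genericSet m] μ).NeBot := by
  rw [← mem_closure_iff_nhdsWithin_neBot]
  set v : Fin n → ℂ := fun l => n * (l : ℕ) - ∑ k : Fin n, ((k : ℕ) : ℂ) with hv
  set B : Set ℝ := ⋃ l : Fin n, ⋃ k : Fin n, range fun j : ℤ =>
    (2 * (j : ℝ) + |(m k : ℝ) - m l| - 2 * ((μ k).re - (μ l).re))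
      / (2 * (n * (((k : ℕ) : ℝ) - (l : ℕ)))) with hB
  have hBc : B.Countable :=
    countable_iUnion fun l => countable_iUnion fun k => countable_range _
  have hcont : Continuous fun t : ℝ => fun l => μ l + t * v l := by fun_prop
  have h0 : (fun l => μ l + ((0 : ℝ) : ℂ) * v l) = μ := by
    funext l; simp
  rw [← h0]
  refine map_mem_closure hcont ((hBc.dense_compl ℝ) 0) fun t ht => ⟨?_, fun l k hlk hsim => ht ?_⟩
  · have hμ' : ∑ l, μ l = 0 := hμ
    simp only [hyperplane, mem_ofPred_eq, Finset.sum_add_distrib, hμ', zero_add, ← Finset.mul_sum]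
    simp [hv, Finset.sum_sub_distrib, ← Finset.mul_sum]
  · obtain ⟨j, hj⟩ := hsim
    refine mem_iUnion.2 ⟨l, mem_iUnion.2 ⟨k, j, ?_⟩⟩
    have h1 := congrArg Complex.re hj
    have hre : (((|m k - m l| : ℤ) : ℂ)).re = |(m k : ℝ) - m l| := by
      rw [intCast_re]; push_cast; rfl
    simp only [sub_re, hre, hv] at h1
    have hn : (0 : ℝ) < n := by exact_mod_cast (Fin.pos l)
    have hkl : ((k : ℕ) : ℝ) - (l : ℕ) ≠ 0 := by
      rw [sub_ne_zero]
      intro h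
      exact hlk (Fin.ext (by exact_mod_cast h.symm))
    rw [div_eq_iff (by positivity)]
    simp at h1
    linarith

theorem genericSet_subset_hyperplane {n : ℕ} (m : Fin n → ℤ) : genericSet m ⊆ hyperplane n :=
  fun _ h => h.1

/-- The contour integral does not depend on the contour. For generic indices it is a sum of
residues; the general case follows by continuity in the index. -/
theorem contourIntegral_eq_of_admissible {n : ℕ} (hn : 1 ≤ n) {μ : Fin n → ℂ}
    (hμ : μ ∈ hyperplane n) {m : Fin n → ℤ} {x : ℝ} (hx : 0 < x) {κ : ℤ} {σ ρ T σ' ρ' T' : ℝ}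
    (h : Admissible μ (shift m κ) σ ρ T) (h' : Admissible μ (shift m κ) σ' ρ' T') :
    contourIntegral σ ρ T (integrand μ (shift m κ) x)
      = contourIntegral σ' ρ' T' (integrand μ (shift m κ) x) := by
  have := neBot_nhdsWithin_genericSet hμ m
  have hsub := nhdsWithin_mono μ (genericSet_subset_hyperplane m)
  have h1 := (tendsto_contourIntegral hn hx h).mono_left hsub
  have h2 := (tendsto_contourIntegral hn hx h').mono_left hsub
  refine tendsto_nhds_unique (h1.congr' ?_) h2
  filter_upwards [nhdsWithin_le_nhds h.eventually, nhdsWithin_le_nhds h'.eventually,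
    self_mem_nhdsWithin] with ν a1 a2 hν
  rw [contourIntegral_eq_tsum hn hν.1 hν.2 hx a1, contourIntegral_eq_tsum hn hν.1 hν.2 hx a2]

/-- A contour for each index `μ + κ e` together with bounds that are uniform for `ν` near `μ`,
which make the Fourier series of the Bessel kernel converge uniformly there. -/
theorem exists_uniform_contours {n : ℕ} (hn : 1 ≤ n) {μ : Fin n → ℂ} (m : Fin n → ℤ)
    {x : ℝ} (hx : 0 < x) :
    ∃ (σ T : ℝ) (ρ b : ℤ → ℝ), Summable b ∧
      (∀ κ, Admissible μ (shift m κ) σ (ρ κ) T) ∧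
      ∀ᶠ ν in 𝓝[hyperplane n] μ, ∀ κ, Admissible ν (shift m κ) σ (ρ κ) T ∧
        ‖contourIntegral σ (ρ κ) T (integrand ν (shift m κ) x)‖ ≤ b κ := by
  obtain ⟨R₁, hR₁⟩ := exists_re_bound μ
  -- the real part of `-i μ_l` is the imaginary part of `μ_l`
  obtain ⟨R₂, hR₂⟩ := exists_re_bound fun l => μ l * -I
  simp only [mul_neg, neg_re, mul_re, I_re, mul_zero, I_im, mul_one, zero_sub, neg_neg] at hR₂
  set R := max R₁ R₂ with hR
  have hre : ∀ l, |(μ l).re| < R := fun l => (hR₁ l).trans_le (le_max_left _ _)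
  have him : ∀ l, |(μ l).im| < R := fun l => (hR₂ l).trans_le (le_max_right _ _)
  have hR0 : 0 ≤ R := (abs_nonneg _).trans (hre ⟨0, hn⟩).le
  obtain ⟨D, K, hD0, hDK⟩ := exists_bound_contourIntegral_shift hn m hR0 hx
  have hdecay : (n : ℝ) * (2 * (-(R + 2)) - 1) < -1 := by
    have : (1 : ℝ) ≤ n := by exact_mod_cast hn
    nlinarith
  obtain ⟨C⟩ : Nonempty (∀ κ, Contour μ (shift m κ)) :=
    ⟨fun κ => (contour_nonempty μ (shift m κ)).some⟩
  set ρ : ℤ → ℝ := fun κ => if K ≤ |(κ : ℝ)| then -(R + 2) else (C κ).ρ with hρ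
  -- a straight line for large `|κ|`, and any bump that encloses the poles for the other `κ`
  have hadm : ∀ κ, Admissible μ (shift m κ) (-(R + 2)) (ρ κ) R := by
    intro κ
    refine ⟨hdecay, fun l => ?_, him⟩
    simp only [hρ]
    split_ifs with hκ
    · exact (hDK μ (fun l => (hre l).le) (fun l => (him l).le) κ hκ).1 l
    · exact (C κ).lt_ρ l
  have hfin : {κ : ℤ | ¬ K ≤ |(κ : ℝ)|}.Finite := by
    refine (Set.finite_Icc (-⌈K⌉) ⌈K⌉).subset fun κ hκ => ?_
    have h1 : |(κ : ℝ)| < K := not_le.1 hκ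
    have h2 : ((|κ| : ℤ) : ℝ) ≤ (⌈K⌉ : ℤ) := by
      rw [Int.cast_abs]; exact h1.le.trans (Int.le_ceil K)
    exact abs_le.1 (by exact_mod_cast h2)
  set f : ℤ → (Fin n → ℂ) → ℂ := fun κ ν =>
    contourIntegral (-(R + 2)) (ρ κ) R (integrand ν (shift m κ) x) with hf
  set b : ℤ → ℝ := fun κ => D * (1 + (κ : ℝ) ^ 2)⁻¹
    + if K ≤ |(κ : ℝ)| then 0 else ‖f κ μ‖ + 1 with hb
  refine ⟨-(R + 2), R, ρ, b, ?_, hadm, ?_⟩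
  · refine (summable_inv_one_add_int_sq.mul_left D).add
      (summable_of_hasFiniteSupport (hfin.subset fun κ hκ h => hκ (if_pos h)))
  have ere : ∀ᶠ ν : Fin n → ℂ in 𝓝[hyperplane n] μ, ∀ l, |(ν l).re| < R := by
    refine nhdsWithin_le_nhds (eventually_all.2 fun l => ?_)
    have : Continuous fun κ : Fin n → ℂ => |(κ l).re| := by fun_prop
    exact this.continuousAt.eventually_lt continuousAt_const (hre l)
  have eim : ∀ᶠ ν : Fin n → ℂ in 𝓝[hyperplane n] μ, ∀ l, |(ν l).im| < R := by
    refine nhdsWithin_le_nhds (eventually_all.2 fun l => ?_)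
    have : Continuous fun κ : Fin n → ℂ => |(κ l).im| := by fun_prop
    exact this.continuousAt.eventually_lt continuousAt_const (him l)
  have efin : ∀ᶠ ν in 𝓝[hyperplane n] μ, ∀ κ ∈ {κ : ℤ | ¬ K ≤ |(κ : ℝ)|},
      Admissible ν (shift m κ) (-(R + 2)) (ρ κ) R ∧ ‖f κ ν‖ < ‖f κ μ‖ + 1 := by
    refine (eventually_all_finite hfin).2 fun κ _ => ?_
    exact ((hadm κ).eventually.filter_mono nhdsWithin_le_nhds).and
      ((tendsto_contourIntegral hn hx (hadm κ)).norm.eventually_lt_const (lt_add_one _))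
  filter_upwards [ere, eim, efin] with ν h1 h2 h3 κ
  by_cases hκ : K ≤ |(κ : ℝ)|
  · obtain ⟨h4, h5⟩ := hDK ν (fun l => (h1 l).le) (fun l => (h2 l).le) κ hκ
    simp only [hρ, hb, hκ, if_true, add_zero]
    exact ⟨⟨hdecay, h4, h2⟩, h5 R⟩
  · obtain ⟨h4, h5⟩ := h3 κ hκ
    refine ⟨h4, h5.le.trans ?_⟩
    simp only [hb, hκ, if_false]
    have : 0 ≤ D * (1 + (κ : ℝ) ^ 2)⁻¹ := by positivity
    linarith

theorem kernelTerm_eq {n : ℕ} {μ : Fin n → ℂ} {m : Fin n → ℤ}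
    (C : ∀ k : ℤ, Contour μ (shift m k)) {x : ℝ} (hx : 0 < x) (φ : ℝ) (κ : ℤ) :
    kernelTerm μ m C (x * exp (φ * I)) κ
      = 1 / (2 * Real.pi * I) * contourIntegral (C κ).σ (C κ).ρ (C κ).T
          (integrand μ (shift m κ) x) * exp (φ * I) ^ κ := by
  have hx' : (x : ℂ) ≠ 0 := by exact_mod_cast hx.ne'
  have hnorm : ‖(x * exp (φ * I) : ℂ)‖ = x := by
    rw [norm_mul, Complex.norm_exp_ofReal_mul_I, mul_one, Complex.norm_real,
      Real.norm_of_nonneg hx.le]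
  rw [kernelTerm, hnorm, mul_div_cancel_left₀ _ hx', smallKernel]

end BesselKernel

end

theorem mainTheorem6 {n : ℕ} (hn : 1 ≤ n) (μ : Fin n → ℂ) (hμ : μ ∈ BesselKernel.hyperplane n)
    (m : Fin n → ℤ) (C : ∀ k : ℤ, BesselKernel.Contour μ (BesselKernel.shift m k))
    (x : ℝ) (hx : 0 < x) (φ : ℝ) :
    (∀ k : ℤ, BesselKernel.ContourConverges (C k).σ (C k).T
        (BesselKernel.integrand μ (BesselKernel.shift m k) x)) ∧
    Summable (BesselKernel.kernelTerm μ m C (x * exp (φ * I))) ∧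
    (BesselKernel.Generic μ m → ∀ ε : ℤˣ,
      BesselKernel.kernel μ m C (x * exp (φ * I)) = BesselKernel.connectionSum ε μ m x φ) ∧
    (𝓝[BesselKernel.genericSet m] μ).NeBot ∧
    (∀ ε : ℤˣ,
      Tendsto (fun ν => BesselKernel.connectionSum ε ν m x φ) (𝓝[BesselKernel.genericSet m] μ)
        (𝓝 (BesselKernel.kernel μ m C (x * exp (φ * I))))) := by
  have hC : ∀ k, BesselKernel.Admissible μ (BesselKernel.shift m k) (C k).σ (C k).ρ (C k).T :=
    fun k => (C k).admissible hn hμ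
  obtain ⟨σ, T, ρ, b, hb, hadm, hev⟩ :=
    BesselKernel.exists_uniform_contours hn (μ := μ) m hx
  have hterm : ∀ κ, BesselKernel.kernelTerm μ m C (x * exp (φ * I)) κ
      = 1 / (2 * Real.pi * I) * BesselKernel.contourIntegral σ (ρ κ) T
          (BesselKernel.integrand μ (BesselKernel.shift m κ) x) * exp (φ * I) ^ κ := fun κ => by
    rw [BesselKernel.kernelTerm_eq C hx,
      BesselKernel.contourIntegral_eq_of_admissible hn hμ hx (hC κ) (hadm κ)]
  have hbound : ∀ ν κ, ‖BesselKernel.contourIntegral σ (ρ κ) T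
      (BesselKernel.integrand ν (BesselKernel.shift m κ) x)‖ ≤ b κ →
      ‖1 / (2 * Real.pi * I) * BesselKernel.contourIntegral σ (ρ κ) T
          (BesselKernel.integrand ν (BesselKernel.shift m κ) x) * exp (φ * I) ^ κ‖
        ≤ ‖(1 / (2 * Real.pi * I) : ℂ)‖ * b κ := fun ν κ h => by
    rw [norm_mul, norm_zpow, Complex.norm_exp_ofReal_mul_I, one_zpow, mul_one, norm_mul]
    exact mul_le_mul_of_nonneg_left h (norm_nonneg _)
  have hμev := hev.self_of_nhdsWithin hμ
  have hsub := nhdsWithin_mono μ (BesselKernel.genericSet_subset_hyperplane m)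
  have hev' := hev.filter_mono hsub
  refine ⟨fun k => (hC k).contourConverges hn hμ hx, ?_, fun hg ε => ?_,
    BesselKernel.neBot_nhdsWithin_genericSet hμ m, fun ε => ?_⟩
  · refine Summable.of_norm_bounded (hb.mul_left ‖(1 / (2 * Real.pi * I) : ℂ)‖) fun κ => ?_
    rw [hterm]
    exact hbound μ κ (hμev κ).2
  · rw [BesselKernel.kernel, ← BesselKernel.connectionSum_eq_tsum hn hμ hg hx hC φ ε]
    simp only [BesselKernel.kernelTerm_eq C hx]
  · rw [BesselKernel.kernel, tsum_congr hterm]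
    have hlim := (tendsto_tsum_of_dominated_convergence
      (𝓕 := 𝓝[BesselKernel.genericSet m] μ)
      (f := fun ν κ => 1 / (2 * Real.pi * I) * BesselKernel.contourIntegral σ (ρ κ) T
          (BesselKernel.integrand ν (BesselKernel.shift m κ) x) * exp (φ * I) ^ κ)
      (hb.mul_left ‖(1 / (2 * Real.pi * I) : ℂ)‖)
      (fun κ => (((BesselKernel.tendsto_contourIntegral hn hx (hadm κ)).mono_left
        hsub).const_mul _).mul_const _)
      (hev'.mono fun ν h κ => hbound ν κ (h κ).2)).const_mul (1 / (2 * Real.pi) : ℂ)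
    refine hlim.congr' ?_
    filter_upwards [hev', self_mem_nhdsWithin] with ν h hν
    exact BesselKernel.connectionSum_eq_tsum hn hν.1 hν.2 hx (σ := fun _ => σ) (T := fun _ => T)
      (fun κ => (h κ).1) φ ε
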